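/- Let $(K,d)$ be a compact metric space and let $f:K\to K$ be a continuous map that is Ruelle-expanding with constants $r>0$, $0<\lambda<1$, $c>0$. That is, $d(x,y)>c$ whenever $x\ne y$ and $f(x)=f(y)$; and for all $x\in K$ and $a\in f^{-1}(\{x\})$ there is a map $\phi$ from the open ball $B_r(x)$ to $K$ with $\phi(x)=a$, $f(\phi(y))=y$ and $d(\phi(y),\phi(z))\le\lambda d(y,z)$ for all $y,z\in B_r(x)$. For $n\ge 1$ let $N_n(f)$ be the number of points $x$ with $f^n(x)=x$. Then $N_n(f)$ is finite for every $n\geq 1$, and the Artin–Mazur zeta function $\zeta_f(z)=\exp\left(\sum_{n\ge1}\frac{N_n(f)}{n}z^n\right)$ is a rational function. Explicitly, the following holds. 1. There is an expansivity constant for $f$, i.e. an $\varepsilon>0$ such that $d(f^n(x),f^n(y))\le\varepsilon$ for all $n\ge0$ implies $x=y$. For every $\delta>0$ there is a Markov cover of $K$ of diameter less than $\delta$, i.e. a finite cover $\{R_1,\dots,R_k\}$ of $K$ such that each $R_i$ has diameter less than $\delta$ and equals the closure of its interior, the interiors $\mathring R_i$ are pairwise disjoint, and $f(\mathring R_i)\cap\mathring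 R_j\ne\emptyset$ implies $\mathring R_j\subseteq f(\mathring R_i)$. 2. Let $\varepsilon$ be any expansivity constant for $f$ and $\{R_1,\dots,R_k\}$ any Markov cover of $K$ of diameter less than $\min\{\varepsilon,c/2\}$. Put $A_{ij}=1$ if $f(\mathring R_i)\cap\mathring R_j\neq\emptyset$ and $A_{ij}=0$ otherwise. For $1\le r\le k$ let $I_r$ be the set of all $\{s_1<\dots<s_r\}\subseteq\{1,\dots,k\}$ with $\bigcap_i R_{s_i}\ne\emptyset$, and let $B^{(r)}$ be the matrix indexed by $I_r$ whose entry at $(s,t)$ is $\mathrm{sgn}(\mu)$ if there is a unique permutation $\mu$ of $\{1,\dots,r\}$ with $A_{s_i t_{\mu(i)}}=1$ for all $i$, and is $0$ otherwise. Then $$\zeta_f(z)=\frac{\prod_{r\text{ even}}\det(I-zB^{(r)})}{\prod_{r\text{ odd}}\det(I-zB^{(r)})},$$ where $1\le r\le k$ (the determinant being $1$ if $I_r=\emptyset$). This holds as an identity of formal power series, and also as an identity of functions on some disc around $0$, on which the series $\sum_{n\ge1}\frac{N_n(f)}{n}z^n$ converges. -/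

import Mathlib

open scoped PowerSeries Polynomial

namespace RuelleZeta

/-- `f` is continuous and Ruelle-expanding with constants `r`, `lam`, `c`. The local inverse
`φ : B_r(x) → K` is represented by a map on `K` of which only the values on the ball are used. -/
structure IsRuelleExpandingWith {K : Type*} [MetricSpace K] (f : K → K) (r lam c : ℝ) : Prop where
  continuous : Continuous f
  r_pos : 0 < r
  lam_pos : 0 < lam
  lam_lt_one : lam < 1
  c_pos : 0 < c
  separated : ∀ x y : K, x ≠ y → f x = f y → c < dist x y
  exists_branch : ∀ x a : K, f a = x → ∃ φ : K → K, φ x = a ∧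
    (∀ y ∈ Metric.ball x r, f (φ y) = y) ∧
    ∀ y ∈ Metric.ball x r, ∀ z ∈ Metric.ball x r, dist (φ y) (φ z) ≤ lam * dist y z

/-- `ε` is an expansivity constant for `f`. -/
def IsExpansivityConstant {K : Type*} [MetricSpace K] (f : K → K) (ε : ℝ) : Prop :=
  0 < ε ∧ ∀ x y : K, (∀ n : ℕ, dist (f^[n] x) (f^[n] y) ≤ ε) → x = y

/-- `N_n(f)`, the number of points `x` with `f^n(x) = x`. -/
noncomputable def periodicCount {K : Type*} (f : K → K) (n : ℕ) : ℕ :=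
  (Function.ptsOfPeriod f n).ncard

/-- The formal series `∑_{n ≥ 1} N_n(f) zⁿ / n`. -/
noncomputable def zetaExponent {K : Type*} (f : K → K) : ℂ⟦X⟧ :=
  PowerSeries.mk fun n => if n = 0 then 0 else (periodicCount f n : ℂ) / (n : ℂ)

theorem hasSubst_zetaExponent {K : Type*} (f : K → K) :
    PowerSeries.HasSubst (zetaExponent f) := by
  apply PowerSeries.HasSubst.of_constantCoeff_zero'
  simp [zetaExponent]

/-- The Artin–Mazur zeta function `exp (∑_{n ≥ 1} N_n(f) zⁿ / n)` as a formal power series. -/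
noncomputable def zetaSeries {K : Type*} (f : K → K) : ℂ⟦X⟧ :=
  (PowerSeries.exp ℂ).subst (zetaExponent f)

/-- A formal power series that is the quotient of two polynomials. -/
def IsRationalSeries (F : ℂ⟦X⟧) : Prop :=
  ∃ P Q : ℂ[X], Q ≠ 0 ∧ (Q : ℂ⟦X⟧) * F = (P : ℂ⟦X⟧)

/-- `R_1, …, R_k` is a finite cover by proper sets (closures of their interiors) with pairwise
disjoint interiors, with diameters less than `δ`, and with the Markov property. -/
structure IsMarkovCover {K : Type*} [MetricSpace K] (f : K → K) {k : ℕ} (R : Fin k → Set K)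
    (δ : ℝ) : Prop where
  cover : ⋃ i, R i = Set.univ
  diam_lt : ∀ i, Metric.diam (R i) < δ
  proper : ∀ i, closure (interior (R i)) = R i
  disjoint : ∀ i j, i ≠ j → interior (R i) ∩ interior (R j) = ∅
  markov : ∀ i j, (f '' interior (R i) ∩ interior (R j)).Nonempty →
    interior (R j) ⊆ f '' interior (R i)

open Classical in
/-- The transition matrix `A` of the cover. -/
noncomputable def transitionMatrix {K : Type*} [MetricSpace K] (f : K → K) {k : ℕ}
    (R : Fin k → Set K) : Matrix (Fin k) (Fin k) ℕ :=
  Matrix.of fun i j => if (f '' interior (R i) ∩ interior (R j)).Nonempty then 1 else 0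

open Classical in
/-- `I_r`, the sets of `r` indices whose members of the cover have a common point. -/
noncomputable def overlaps {K : Type*} {k : ℕ} (R : Fin k → Set K) (r : ℕ) :
    Finset (Finset (Fin k)) :=
  (Finset.powersetCard r Finset.univ).filter fun s => (⋂ i ∈ s, R i).Nonempty

open Classical in
theorem card_of_mem_overlaps {K : Type*} {k : ℕ} {R : Fin k → Set K} {r : ℕ}
    (s : overlaps R r) : s.1.card = r :=
  (Finset.mem_powersetCard.mp (Finset.mem_filter.mp s.2).1).2

/-- The increasing enumeration `s_1 < … < s_r` of `s ∈ I_r`. -/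
noncomputable def overlapElem {K : Type*} {k : ℕ} {R : Fin k → Set K} {r : ℕ}
    (s : overlaps R r) (i : Fin r) : Fin k :=
  s.1.orderEmbOfFin (card_of_mem_overlaps s) i

open Classical in
/-- The signed transition matrix `B^{(r)}`, indexed by `I_r`: the entry at `(s, t)` is `sgn μ` if
there is a unique permutation `μ` with `A_{s_i t_{μ(i)}} = 1` for all `i`, and `0` otherwise. -/
noncomputable def signedMatrix {K : Type*} [MetricSpace K] (f : K → K) {k : ℕ}
    (R : Fin k → Set K) (r : ℕ) : Matrix (overlaps R r) (overlaps R r) ℂ :=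
  Matrix.of fun s t =>
    if h : ∃! μ : Equiv.Perm (Fin r),
        ∀ i, transitionMatrix f R (overlapElem s i) (overlapElem t (μ i)) = 1 then
      ((Equiv.Perm.sign h.choose : ℤ) : ℂ)
    else 0

/-- The polynomial `∏_{r even} det (I - z B^{(r)})`, over `1 ≤ r ≤ k`. When `I_r` is empty,
the determinant is `1`. -/
noncomputable def evenDet {K : Type*} [MetricSpace K] (f : K → K) {k : ℕ}
    (R : Fin k → Set K) : ℂ[X] :=
  ∏ r ∈ (Finset.Icc 1 k).filter (fun r => Even r),
    (1 - (Polynomial.X : ℂ[X]) • (signedMatrix f R r).map Polynomial.C).det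

/-- The polynomial `∏_{r odd} det (I - z B^{(r)})`, over `1 ≤ r ≤ k`. -/
noncomputable def oddDet {K : Type*} [MetricSpace K] (f : K → K) {k : ℕ}
    (R : Fin k → Set K) : ℂ[X] :=
  ∏ r ∈ (Finset.Icc 1 k).filter (fun r => Odd r),
    (1 - (Polynomial.X : ℂ[X]) • (signedMatrix f R r).map Polynomial.C).det

end RuelleZeta

/-! A point on the boundaries of several members of the cover has several itineraries, so the traces
of the powers of `A` overcount periodic points; the matrices `B^(q)` correct this as exterior powers
do in a determinant. Two members that meet cannot both have a transition to the same member
(`IsMarkovCover.unique_pred`), so at most one permutation is admissible and the entries of `B^(q)`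
are plain `q × q` minors of `A` (`IsMarkovCover.signedMatrix_eq_det`). For `f^n(x) = x`, let `M_x`
be the product along the orbit of `A` restricted to the members containing the successive points. By
compactness and expansivity, each closed path of non-zero entries of `B^(q)` is followed by exactly
one periodic point; hence `tr (B^(q))^n = ∑_x tr Λ^q M_x` (`IsMarkovCover.trace_signedMatrix_pow`).
Every member containing `f x` has exactly one predecessor containing `x`, so `M_x` fixes the
indicator row vector of the members at `x`. Thus `∑_q (-1)^q tr Λ^q M_x = det (1 - M_x) = 0`; moving
the term `q = 0` aside, `x` is counted exactly once. This gives `N_n = ∑_{q ≥ 1} (-1)^(q+1) tr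
(B^(q))^n`, and `exp (∑ tr(B^n) z^n / n) = 1 / det (1 - zB)` finishes the computation.

Markov covers come from shadowing. The points shadowed by pseudo-orbits in a finite net form small
closed sets whose images are unions of such sets. Closures of the atoms of this cover are Markov,
because preimages are unique at scales below `c`. -/

namespace RuelleZeta

/-! ### Compound matrices as exterior powers -/

/-- The increasing enumeration of a set of `r` indices. -/
def enum {k r : ℕ} (s : Set.powersetCard (Fin k) r) : Fin r → Fin k :=
  Set.powersetCard.ofFinEmbEquiv.symm s

theorem enum_injective {k r : ℕ} (s : Set.powersetCard (Fin k) r) :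
    Function.Injective (enum s) :=
  (Set.powersetCard.ofFinEmbEquiv.symm s).injective

theorem range_enum {k r : ℕ} (s : Set.powersetCard (Fin k) r) :
    Set.range (enum s) = (s.1 : Set (Fin k)) := by
  unfold enum
  rw [Set.powersetCard.ofFinEmbEquiv_symm_apply]
  exact Finset.range_orderEmbOfFin _ _

theorem enum_mem {k r : ℕ} (s : Set.powersetCard (Fin k) r) (i : Fin r) : enum s i ∈ s.1 := by
  have : enum s i ∈ Set.range (enum s) := ⟨i, rfl⟩
  rwa [range_enum] at this

theorem exists_enum_eq {k r : ℕ} {s : Set.powersetCard (Fin k) r} {a : Fin k} (ha : a ∈ s.1) :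
    ∃ i, enum s i = a := by
  have : a ∈ Set.range (enum s) := by rwa [range_enum]
  exact this

/-- The `r`-th compound matrix: its entries are the `r × r` minors. -/
noncomputable def compound {k : ℕ} (r : ℕ) (M : Matrix (Fin k) (Fin k) ℂ) :
    Matrix (Set.powersetCard (Fin k) r) (Set.powersetCard (Fin k) r) ℂ :=
  Matrix.of fun s t => (M.submatrix (enum s) (enum t)).det

/-- Pairing wedges of basis vectors with dual wedges gives minors. Multiplicativity (Cauchy–Binet)
then reduces to functoriality of the exterior power. -/
theorem compound_eq_toMatrix {k : ℕ} (r : ℕ) (M : Matrix (Fin k) (Fin k) ℂ) :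
    compound r M = LinearMap.toMatrix ((Pi.basisFun ℂ (Fin k)).exteriorPower r)
      ((Pi.basisFun ℂ (Fin k)).exteriorPower r) (exteriorPower.map r (Matrix.toLin' M)) := by
  ext s t
  rw [LinearMap.toMatrix_apply, exteriorPower.basis_repr_apply, exteriorPower.basis_apply,
    exteriorPower.ιMulti_family, exteriorPower.map_apply_ιMulti,
    exteriorPower.ιMultiDual_apply_ιMulti, compound, Matrix.of_apply, ← Matrix.det_transpose]
  congr 1
  ext i j
  simp [enum]

theorem compound_mul {k : ℕ} (r : ℕ) (M N : Matrix (Fin k) (Fin k) ℂ) :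
    compound r (M * N) = compound r M * compound r N := by
  simp only [compound_eq_toMatrix, Matrix.toLin'_mul, exteriorPower.map_comp]
  rw [LinearMap.toMatrix_comp _ ((Pi.basisFun ℂ (Fin k)).exteriorPower r)]

theorem compound_one {k : ℕ} (r : ℕ) : compound r (1 : Matrix (Fin k) (Fin k) ℂ) = 1 := by
  simp only [compound_eq_toMatrix, Matrix.toLin'_one, exteriorPower.map_id, LinearMap.toMatrix_id]

theorem compound_list_prod {k : ℕ} (r : ℕ) (l : List (Matrix (Fin k) (Fin k) ℂ)) :
    compound r l.prod = (l.map (compound r)).prod :=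
  map_list_prod (MonoidHom.mk ⟨compound r, compound_one r⟩ (compound_mul r)) l

theorem trace_compound {k : ℕ} (r : ℕ) (M : Matrix (Fin k) (Fin k) ℂ) :
    (compound r M).trace = ∑ s ∈ Finset.univ.powersetCard r,
      (M.submatrix (Subtype.val : s → Fin k) (Subtype.val : s → Fin k)).det := by
  unfold Matrix.trace
  symm
  refine Finset.sum_bij' (fun s hs => ⟨s, (Finset.mem_powersetCard.mp hs).2⟩) (fun s _ => s.1)
    (by simp) (fun s _ => Finset.mem_powersetCard.mpr ⟨Finset.subset_univ _, s.2⟩)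
    (by simp) (by simp) ?_
  intro s hs
  have hc := (Finset.mem_powersetCard.mp hs).2
  let S : Set.powersetCard (Fin k) r := ⟨s, hc⟩
  have hb : Function.Bijective (fun i => (⟨enum S i, enum_mem S i⟩ : s)) :=
    ⟨fun i j h => enum_injective S (Subtype.ext_iff.mp h), fun a => by
      obtain ⟨i, hi⟩ := exists_enum_eq (s := S) a.2
      exact ⟨i, Subtype.ext hi⟩⟩
  rw [← Matrix.det_submatrix_equiv_self (Equiv.ofBijective _ hb)]
  rfl

theorem trace_compound_zero {k : ℕ} (M : Matrix (Fin k) (Fin k) ℂ) :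
    (compound 0 M).trace = 1 := by
  simp [trace_compound]

/-- Both sides are the characteristic polynomial at 1, whose coefficients are signed sums of
principal minors. -/
theorem sum_neg_one_pow_mul_trace_compound {k : ℕ} (M : Matrix (Fin k) (Fin k) ℂ) :
    ∑ r ∈ Finset.range (k + 1), (-1) ^ r * (compound r M).trace = (1 - M).det := by
  have h : (1 - M).det = M.charpoly.eval 1 := by simp [Matrix.eval_charpoly]
  rw [h, Polynomial.eval_eq_sum_range, Matrix.charpoly_natDegree_eq_dim, Fintype.card_fin]
  conv_rhs => rw [← Finset.sum_range_reflect]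
  refine Finset.sum_congr rfl fun r hr => ?_
  have hrk : r ≤ k := by simpa [Nat.lt_succ_iff] using hr
  have := M.charpoly_coeff_eq_sum_minors r (by simpa using hrk)
  rw [Fintype.card_fin] at this
  rw [Nat.add_sub_cancel, this, one_pow, mul_one, trace_compound]

/-- A row vector fixed by `M` makes the alternating sum of the traces of the compounds of positive
order equal to one. -/
theorem sum_trace_compound_eq_one {k : ℕ} {M : Matrix (Fin k) (Fin k) ℂ} {u : Fin k → ℂ}
    (hu : u ≠ 0) (huM : Matrix.vecMul u M = u) :
    ∑ r ∈ Finset.Icc 1 k, (-1) ^ (r + 1) * (compound r M).trace = 1 := by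
  have h0 : (1 - M).det = 0 := by
    rw [← Matrix.exists_vecMul_eq_zero_iff]
    exact ⟨u, hu, by rw [Matrix.vecMul_sub, huM, Matrix.vecMul_one, sub_self]⟩
  have h := sum_neg_one_pow_mul_trace_compound M
  rw [h0, Finset.sum_range_succ', trace_compound_zero] at h
  have : ∑ r ∈ Finset.Icc 1 k, (-1) ^ (r + 1) * (compound r M).trace =
      -∑ r ∈ Finset.range k, (-1) ^ (r + 1) * (compound (r + 1) M).trace := by
    rw [← Finset.sum_neg_distrib, ← Finset.Ico_add_one_right_eq_Icc, Finset.sum_Ico_eq_sum_range]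
    refine Finset.sum_congr (by simp) fun r _ => ?_
    rw [add_comm 1 r]; ring
  rw [this]
  linear_combination -h

/-! ### Traces of matrix products as sums over closed paths -/

theorem list_ofFn_prod_apply {ι : Type*} [Fintype ι] [DecidableEq ι] (n : ℕ)
    (M : Fin n → Matrix ι ι ℂ) (s t : ι) :
    (List.ofFn M).prod s t = ∑ w : Fin (n + 1) → ι,
      if w 0 = s ∧ w (Fin.last n) = t then ∏ j : Fin n, M j (w j.castSucc) (w j.succ) else 0 := by
  induction n generalizing s with
  | zero =>
    rw [← Equiv.sum_comp (Equiv.funUnique (Fin 1) ι).symm]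
    simp only [List.ofFn_zero, List.prod_nil, Matrix.one_apply, Finset.univ_eq_empty,
      Finset.prod_empty]
    rw [Finset.sum_eq_single s]
    · simp [Equiv.funUnique]
    · intro b _ hb
      simp [Equiv.funUnique, hb]
    · simp
  | succ n ih =>
    rw [List.ofFn_succ, List.prod_cons, Matrix.mul_apply,
      ← Equiv.sum_comp (Fin.consEquiv fun _ => ι), Fintype.sum_prod_type]
    symm
    rw [Finset.sum_eq_single s]
    · simp_rw [ih, Finset.mul_sum]
      rw [Finset.sum_comm]
      refine Finset.sum_congr rfl fun w _ => ?_
      rw [Finset.sum_eq_single (w 0)]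
      · rw [Fin.prod_univ_succ]
        simp [Fin.consEquiv, ← Fin.succ_last]
      · intro b _ hb
        simp [hb.symm]
      · simp
    · intro b _ hb
      simp [Fin.consEquiv, hb]
    · simp

theorem trace_list_ofFn_prod {ι : Type*} [Fintype ι] [DecidableEq ι] (n : ℕ)
    (M : Fin n → Matrix ι ι ℂ) :
    (List.ofFn M).prod.trace = ∑ w : Fin (n + 1) → ι,
      if w 0 = w (Fin.last n) then ∏ j : Fin n, M j (w j.castSucc) (w j.succ) else 0 := by
  simp only [Matrix.trace, Matrix.diag_apply, list_ofFn_prod_apply]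
  rw [Finset.sum_comm]
  refine Finset.sum_congr rfl fun w _ => ?_
  rw [Finset.sum_eq_single (w 0)]
  · simp [eq_comm]
  · intro b _ hb
    simp [hb.symm]
  · simp

/-! ### Determinants and traces through eigenvalues -/

section Eigenvalues

variable {ι : Type*} [Fintype ι] [DecidableEq ι] (B : Matrix ι ι ℂ)

theorem card_roots_charpoly : Multiset.card B.charpoly.roots = Fintype.card ι := by
  rw [← (IsAlgClosed.splits B.charpoly).natDegree_eq_card_roots, B.charpoly_natDegree_eq_dim]

theorem eval_charpoly_eq_prod (x : ℂ) :
    B.charpoly.eval x = (B.charpoly.roots.map fun a => x - a).prod := by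
  conv_lhs => rw [(IsAlgClosed.splits B.charpoly).eq_prod_roots, B.charpoly_monic.leadingCoeff]
  simp [Polynomial.eval_multiset_prod]

/-- Spectral mapping with multiplicities: `p` splits into linear factors, and each factor
contributes a value of the characteristic polynomial up to sign. -/
theorem det_aeval (p : ℂ[X]) :
    (Polynomial.aeval B p).det = (B.charpoly.roots.map fun a => p.eval a).prod := by
  have key : ∀ m : Multiset ℂ,
      (Polynomial.aeval B (m.map fun b => Polynomial.X - Polynomial.C b).prod).det =
      (B.charpoly.roots.map fun a =>
        ((m.map fun b => Polynomial.X - Polynomial.C b).prod).eval a).prod := by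
    intro m
    induction m using Multiset.induction_on with
    | empty => simp
    | cons b m ih =>
      rw [Multiset.map_cons, Multiset.prod_cons, map_mul, Matrix.det_mul, ih]
      simp only [Polynomial.eval_mul, Multiset.prod_map_mul]
      congr 1
      have h1 : Polynomial.aeval B (Polynomial.X - Polynomial.C b) =
          -(Matrix.scalar ι b - B) := by
        simp [Matrix.algebraMap_eq_diagonal, Matrix.scalar_apply]
      rw [h1, Matrix.det_neg, ← Matrix.eval_charpoly, eval_charpoly_eq_prod,
        ← card_roots_charpoly B, ← Multiset.card_map (fun a => b - a), ← Multiset.prod_map_neg,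
        Multiset.map_map]
      simp
  have hp := (IsAlgClosed.splits p).eq_prod_roots
  rw [hp, map_mul, Matrix.det_mul, key]
  simp only [Polynomial.eval_mul, Multiset.prod_map_mul]
  congr 1
  simp [Matrix.algebraMap_eq_diagonal, card_roots_charpoly]

/-- Applying `det_aeval` to `x - X^n` for every `x` identifies the characteristic polynomial of `B ^
n`, whose roots sum to the trace. -/
theorem trace_pow_eq_sum (n : ℕ) :
    (B ^ n).trace = (B.charpoly.roots.map fun a => a ^ n).sum := by
  have h : (B ^ n).charpoly =
      ((B.charpoly.roots.map fun a => a ^ n).map fun a => Polynomial.X - Polynomial.C a).prod := by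
    refine Polynomial.funext fun x => ?_
    have h2 : Matrix.scalar ι x - B ^ n =
        Polynomial.aeval B (Polynomial.C x - Polynomial.X ^ n) := by
      simp [Matrix.algebraMap_eq_diagonal, Matrix.scalar_apply]
    rw [Matrix.eval_charpoly, h2, det_aeval]
    simp [Polynomial.eval_multiset_prod]
  rw [Matrix.trace_eq_sum_roots_charpoly, h, Polynomial.roots_multiset_prod_X_sub_C]

theorem det_one_sub_X_smul_eq_prod :
    (1 - (Polynomial.X : ℂ[X]) • B.map Polynomial.C).det =
      (B.charpoly.roots.map fun a => 1 - Polynomial.C a * Polynomial.X).prod := by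
  refine Polynomial.funext fun x => ?_
  rw [← Polynomial.coe_evalRingHom, RingHom.map_det]
  have h2 : (Polynomial.evalRingHom x).mapMatrix (1 - (Polynomial.X : ℂ[X]) • B.map Polynomial.C) =
      Polynomial.aeval B (1 - Polynomial.C x * Polynomial.X) := by
    ext i j
    simp [Matrix.algebraMap_eq_diagonal, Matrix.one_apply]
    split_ifs <;> simp [mul_comm]
  rw [h2, det_aeval, Polynomial.coe_evalRingHom]
  simp [Polynomial.eval_multiset_prod, mul_comm x]

end Eigenvalues

/-! ### Formal exponentials of logarithmic series -/

/-- The formal series `∑_{n ≥ 1} a_n zⁿ / n`. -/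
noncomputable def logSeries (a : ℕ → ℂ) : ℂ⟦X⟧ :=
  PowerSeries.mk fun n => if n = 0 then 0 else a n / (n : ℂ)

/-- The formal series `exp (∑_{n ≥ 1} a_n zⁿ / n)`. -/
noncomputable def expLogSeries (a : ℕ → ℂ) : ℂ⟦X⟧ :=
  (PowerSeries.exp ℂ).subst (logSeries a)

theorem constantCoeff_logSeries (a : ℕ → ℂ) : PowerSeries.constantCoeff (logSeries a) = 0 := by
  simp [logSeries]

theorem hasSubst_logSeries (a : ℕ → ℂ) : PowerSeries.HasSubst (logSeries a) :=
  PowerSeries.HasSubst.of_constantCoeff_zero' (constantCoeff_logSeries a)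

theorem derivative_logSeries (a : ℕ → ℂ) :
    PowerSeries.derivative ℂ (logSeries a) = PowerSeries.mk fun n => a (n + 1) := by
  ext n
  rw [PowerSeries.coeff_derivative, logSeries, PowerSeries.coeff_mk, PowerSeries.coeff_mk,
    if_neg n.succ_ne_zero]
  push_cast
  field_simp

theorem logSeries_add (a b : ℕ → ℂ) : logSeries (a + b) = logSeries a + logSeries b := by
  ext n
  simp only [logSeries, PowerSeries.coeff_mk, map_add, Pi.add_apply]
  split_ifs <;> ring

theorem logSeries_neg (a : ℕ → ℂ) : logSeries (-a) = -logSeries a := by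
  ext n
  simp only [logSeries, PowerSeries.coeff_mk, map_neg, Pi.neg_apply]
  split_ifs <;> ring

theorem derivative_expLogSeries (a : ℕ → ℂ) :
    PowerSeries.derivative ℂ (expLogSeries a) =
      expLogSeries a * PowerSeries.derivative ℂ (logSeries a) := by
  rw [expLogSeries, PowerSeries.derivative_subst (hasSubst_logSeries a),
    PowerSeries.derivative_exp]

theorem constantCoeff_expLogSeries (a : ℕ → ℂ) :
    PowerSeries.constantCoeff (expLogSeries a) = 1 := by
  change MvPowerSeries.constantCoeff (PowerSeries.subst (logSeries a) (PowerSeries.exp ℂ)) = 1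
  rw [PowerSeries.constantCoeff_subst (hasSubst_logSeries a), finsum_eq_single _ 0]
  · simp
  · intro d hd
    have : MvPowerSeries.constantCoeff (logSeries a) = 0 := constantCoeff_logSeries a
    rw [map_pow, this, zero_pow hd, smul_zero]

/-- In characteristic zero a derivative and a constant term determine a series. The identities for
exponentials below are reduced to this. -/
theorem eq_one_of_derivative_eq_zero {F : ℂ⟦X⟧} (h : PowerSeries.derivative ℂ F = 0)
    (h0 : PowerSeries.constantCoeff F = 1) : F = 1 :=
  PowerSeries.derivative.ext (by rw [h, Derivation.map_one_eq_zero]) (by rw [h0, map_one])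

theorem expLogSeries_mul_neg (a : ℕ → ℂ) : expLogSeries a * expLogSeries (-a) = 1 := by
  refine eq_one_of_derivative_eq_zero ?_ (by simp [constantCoeff_expLogSeries])
  rw [Derivation.leibniz, derivative_expLogSeries, derivative_expLogSeries, logSeries_neg, map_neg,
    smul_eq_mul, smul_eq_mul]
  ring

theorem expLogSeries_add (a b : ℕ → ℂ) :
    expLogSeries (a + b) = expLogSeries a * expLogSeries b := by
  have h : expLogSeries (a + b) * expLogSeries (-a) * expLogSeries (-b) = 1 := by
    refine eq_one_of_derivative_eq_zero ?_ (by simp [constantCoeff_expLogSeries])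
    simp only [Derivation.leibniz, derivative_expLogSeries, logSeries_neg, logSeries_add, map_neg,
      map_add, smul_eq_mul]
    ring
  linear_combination (expLogSeries a * expLogSeries b) * h -
    expLogSeries (a + b) * expLogSeries b * expLogSeries (-b) * expLogSeries_mul_neg a -
    expLogSeries (a + b) * expLogSeries_mul_neg b

theorem expLogSeries_zero : expLogSeries 0 = 1 := by
  refine eq_one_of_derivative_eq_zero ?_ (constantCoeff_expLogSeries 0)
  have : logSeries 0 = 0 := by
    ext n
    simp [logSeries]
  rw [derivative_expLogSeries, this, map_zero, mul_zero]

theorem expLogSeries_sum {ι : Type*} (s : Finset ι) (a : ι → ℕ → ℂ) :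
    expLogSeries (∑ i ∈ s, a i) = ∏ i ∈ s, expLogSeries (a i) := by
  classical
  induction s using Finset.induction_on with
  | empty => simp [expLogSeries_zero]
  | insert i s hi ih => rw [Finset.sum_insert hi, Finset.prod_insert hi, expLogSeries_add, ih]

/-- The logarithmic derivative of the exponential is `a / (1 - aX)`, which cancels that of `1 - aX`.
-/
theorem expLogSeries_geometric (a : ℂ) :
    expLogSeries (fun n => a ^ n) * (1 - PowerSeries.C a * PowerSeries.X) = 1 := by
  refine eq_one_of_derivative_eq_zero ?_ (by simp [constantCoeff_expLogSeries])
  have h : PowerSeries.derivative ℂ (logSeries fun n => a ^ n) *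
      (1 - PowerSeries.C a * PowerSeries.X) = PowerSeries.C a := by
    rw [derivative_logSeries]
    ext n
    rw [mul_sub, mul_one, mul_left_comm, map_sub, PowerSeries.coeff_C_mul, PowerSeries.coeff_mk]
    cases n with
    | zero => simp
    | succ n => simp [PowerSeries.coeff_succ_mul_X, pow_succ']
  have hd : PowerSeries.derivative ℂ (1 - PowerSeries.C a * PowerSeries.X) =
      -PowerSeries.C a := by
    rw [map_sub, Derivation.map_one_eq_zero, Derivation.leibniz, PowerSeries.derivative_C,
      PowerSeries.derivative_X]
    simp
  rw [Derivation.leibniz, derivative_expLogSeries, hd, smul_eq_mul, smul_eq_mul]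
  linear_combination expLogSeries (fun n => a ^ n) * h

theorem expLogSeries_powerSums (m : Multiset ℂ) :
    expLogSeries (fun n => (m.map fun a => a ^ n).sum) *
      ((m.map fun a => 1 - Polynomial.C a * Polynomial.X).prod : ℂ[X]) = 1 := by
  induction m using Multiset.induction_on with
  | empty => simpa using! expLogSeries_zero
  | cons b m ih =>
    have : (fun n => ((b ::ₘ m).map fun a => a ^ n).sum) =
        (fun n => b ^ n) + fun n => (m.map fun a => a ^ n).sum := by
      funext n
      simp
    rw [this, expLogSeries_add, Multiset.map_cons, Multiset.prod_cons, Polynomial.coe_mul]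
    have h := expLogSeries_geometric b
    push_cast
    rw [mul_mul_mul_comm, ih, mul_one]
    simpa using h

/-- The formal identity `exp (∑ tr(Bⁿ) zⁿ / n) det (I - z B) = 1`. -/
theorem expLogSeries_trace {ι : Type*} [Fintype ι] [DecidableEq ι] (B : Matrix ι ι ℂ) :
    expLogSeries (fun n => (B ^ n).trace) *
      ((1 - (Polynomial.X : ℂ[X]) • B.map Polynomial.C).det : ℂ[X]) = 1 := by
  simp_rw [trace_pow_eq_sum, det_one_sub_X_smul_eq_prod]
  exact expLogSeries_powerSums _

/-! ### Convergence on a disc -/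

/-- On the disc of radius `ρ` the series `∑ a_n zⁿ / n` converges to a logarithm of `1 / P`,
and `P` has no zeros there. -/
def IsLogOfInv (a : ℕ → ℂ) (P : ℂ[X]) (ρ : ℝ) : Prop :=
  ∀ z : ℂ, ‖z‖ < ρ → P.eval z ≠ 0 ∧
    ∃ S : ℂ, HasSum (fun n : ℕ => a (n + 1) / ((n + 1 : ℕ) : ℂ) * z ^ (n + 1)) S ∧
      Complex.exp S * P.eval z = 1

theorem IsLogOfInv.mono {a : ℕ → ℂ} {P : ℂ[X]} {ρ ρ' : ℝ} (h : IsLogOfInv a P ρ) (hle : ρ' ≤ ρ) :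
    IsLogOfInv a P ρ' := fun z hz => h z (hz.trans_le hle)

theorem IsLogOfInv.add {a b : ℕ → ℂ} {P Q : ℂ[X]} {ρ : ℝ} (ha : IsLogOfInv a P ρ)
    (hb : IsLogOfInv b Q ρ) : IsLogOfInv (a + b) (P * Q) ρ := by
  intro z hz
  obtain ⟨h1, S, hS, hS'⟩ := ha z hz
  obtain ⟨h2, T, hT, hT'⟩ := hb z hz
  refine ⟨by simp [h1, h2], S + T, ?_, ?_⟩
  · convert hS.add hT using 2 with n
    simp only [Pi.add_apply]
    ring
  · rw [Complex.exp_add, Polynomial.eval_mul]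
    rw [mul_mul_mul_comm, hS', hT', mul_one]

theorem isLogOfInv_zero (ρ : ℝ) : IsLogOfInv 0 1 ρ := by
  intro z _
  exact ⟨by simp, 0, by simp, by simp⟩

theorem exists_isLogOfInv_sum {ι : Type*} (s : Finset ι) (a : ι → ℕ → ℂ) (P : ι → ℂ[X])
    (h : ∀ i ∈ s, ∃ ρ, 0 < ρ ∧ IsLogOfInv (a i) (P i) ρ) :
    ∃ ρ, 0 < ρ ∧ IsLogOfInv (∑ i ∈ s, a i) (∏ i ∈ s, P i) ρ := by
  classical
  induction s using Finset.induction_on with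
  | empty => exact ⟨1, one_pos, by simpa using isLogOfInv_zero 1⟩
  | insert i s hi ih =>
    obtain ⟨ρ, hρ, h1⟩ := ih fun j hj => h j (Finset.mem_insert_of_mem hj)
    obtain ⟨σ, hσ, h2⟩ := h i (Finset.mem_insert_self i s)
    rw [Finset.sum_insert hi, Finset.prod_insert hi]
    exact ⟨min σ ρ, lt_min hσ hρ, (h2.mono (min_le_left _ _)).add (h1.mono (min_le_right _ _))⟩

theorem exists_isLogOfInv_geometric (a : ℂ) :
    ∃ ρ, 0 < ρ ∧ IsLogOfInv (fun n => a ^ n) (1 - Polynomial.C a * Polynomial.X) ρ := by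
  -- The added 1 keeps the radius meaningful for `a = 0` while still forcing `‖a * z‖ < 1`.
  refine ⟨(‖a‖ + 1)⁻¹, by positivity, fun z hz => ?_⟩
  have hpos : 0 < ‖a‖ + 1 := by positivity
  have hlt : ‖a * z‖ < 1 := by
    rw [norm_mul]
    have h1 : ‖z‖ * (‖a‖ + 1) < 1 := by rwa [← lt_div_iff₀ hpos, one_div]
    nlinarith [norm_nonneg z]
  have hne : 1 - a * z ≠ 0 := by
    intro h
    rw [← sub_eq_zero.mp h] at hlt
    simp at hlt
  refine ⟨by simpa using hne, -Complex.log (1 - a * z), ?_, ?_⟩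
  · convert Complex.hasSum_taylorSeries_neg_log' hlt using 2 with n
    rw [mul_pow]
    push_cast
    ring
  · rw [Complex.exp_neg, Complex.exp_log hne]
    simp [hne]

theorem exists_isLogOfInv_powerSums (m : Multiset ℂ) :
    ∃ ρ, 0 < ρ ∧ IsLogOfInv (fun n => (m.map fun a => a ^ n).sum)
      (m.map fun a => 1 - Polynomial.C a * Polynomial.X).prod ρ := by
  induction m using Multiset.induction_on with
  | empty => exact ⟨1, one_pos, by simpa using! isLogOfInv_zero 1⟩
  | cons b m ih =>
    obtain ⟨ρ, hρ, h1⟩ := ih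
    obtain ⟨σ, hσ, h2⟩ := exists_isLogOfInv_geometric b
    refine ⟨min σ ρ, lt_min hσ hρ, ?_⟩
    have h := (h2.mono (min_le_left σ ρ)).add (h1.mono (min_le_right σ ρ))
    have : (fun n => ((b ::ₘ m).map fun a => a ^ n).sum) =
        (fun n => b ^ n) + fun n => (m.map fun a => a ^ n).sum := by
      funext n
      simp
    rwa [this, Multiset.map_cons, Multiset.prod_cons]

theorem exists_isLogOfInv_trace {ι : Type*} [Fintype ι] [DecidableEq ι] (B : Matrix ι ι ℂ) :
    ∃ ρ, 0 < ρ ∧ IsLogOfInv (fun n => (B ^ n).trace)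
      (1 - (Polynomial.X : ℂ[X]) • B.map Polynomial.C).det ρ := by
  simp_rw [trace_pow_eq_sum, det_one_sub_X_smul_eq_prod]
  exact exists_isLogOfInv_powerSums _

theorem coeff_zero_det_one_sub_X_smul {ι : Type*} [Fintype ι] [DecidableEq ι] (B : Matrix ι ι ℂ) :
    ((1 - (Polynomial.X : ℂ[X]) • B.map Polynomial.C).det).coeff 0 = 1 := by
  rw [Polynomial.coeff_zero_eq_eval_zero]
  exact Matrix.eval_charpolyRev (M := B)

/-! ### Openness and expansivity -/

section Expanding

variable {K : Type*} [MetricSpace K] {f : K → K} {r lam c : ℝ}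

theorem IsRuelleExpandingWith.eq_of_dist_le (hf : IsRuelleExpandingWith f r lam c) {x y : K}
    (h : f x = f y) (hd : dist x y ≤ c) : x = y := by
  by_contra hne
  exact absurd (hf.separated x y hne h) hd.not_gt

/-- The contracting branch at `a` sends a small ball around `f a` into any given neighbourhood of
`a`, and it is a section of `f` there. -/
theorem IsRuelleExpandingWith.isOpenMap (hf : IsRuelleExpandingWith f r lam c) : IsOpenMap f := by
  rw [IsOpenMap.eq_1]
  intro U hU
  rw [isOpen_iff_mem_nhds]
  rintro _ ⟨a, ha, rfl⟩
  obtain ⟨φ, h0, h1, h2⟩ := hf.exists_branch (f a) a rfl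
  obtain ⟨δ, hδ, hsub⟩ := Metric.isOpen_iff.mp hU a ha
  refine Metric.mem_nhds_iff.mpr ⟨min r δ, lt_min hf.r_pos hδ, fun y hy => ?_⟩
  have hyr : y ∈ Metric.ball (f a) r := Metric.ball_subset_ball (min_le_left _ _) hy
  refine ⟨φ y, hsub ?_, h1 y hyr⟩
  have h3 := h2 y hyr (f a) (Metric.mem_ball_self hf.r_pos)
  rw [h0] at h3
  have h4 : dist y (f a) < δ := (Metric.mem_ball.mp hy).trans_le (min_le_right _ _)
  have h5 := hf.lam_lt_one
  rw [Metric.mem_ball]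
  nlinarith [dist_nonneg (x := y) (y := f a), hf.lam_pos]

/-- While two orbits stay close, the branch along one orbit also carries the other, so `dist x y` is
at most `lam ^ n` times a bounded distance. -/
theorem IsRuelleExpandingWith.isExpansivityConstant (hf : IsRuelleExpandingWith f r lam c) :
    IsExpansivityConstant f (min (r / 2) (c / 2)) := by
  have hε : 0 < min (r / 2) (c / 2) := lt_min (half_pos hf.r_pos) (half_pos hf.c_pos)
  refine ⟨hε, fun x y hxy => ?_⟩
  set ε := min (r / 2) (c / 2) with hεdef
  have hr2 : ε ≤ r / 2 := min_le_left _ _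
  have hc2 : ε ≤ c / 2 := min_le_right _ _
  have step : ∀ u v : K, dist u v ≤ ε → dist (f u) (f v) ≤ ε →
      dist u v ≤ lam * dist (f u) (f v) := by
    intro u v h1 h2
    obtain ⟨φ, hφ0, hφ1, hφ2⟩ := hf.exists_branch (f u) u rfl
    have hv : f v ∈ Metric.ball (f u) r := by
      rw [Metric.mem_ball, dist_comm]
      linarith [hf.r_pos]
    have h3 := hφ2 (f u) (Metric.mem_ball_self hf.r_pos) (f v) hv
    rw [hφ0] at h3
    -- Both points are preimages of `f v` within `ε ≤ c / 2` of `u`, hence at most `c` apart.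
    have h4 : φ (f v) = v := by
      refine hf.eq_of_dist_le (hφ1 _ hv) ?_
      have h5 := dist_triangle_left (φ (f v)) v u
      have h6 : lam * dist (f u) (f v) ≤ ε := by
        nlinarith [hf.lam_pos, hf.lam_lt_one, dist_nonneg (x := f u) (y := f v)]
      linarith
    rwa [h4] at h3
  have hpow : ∀ n : ℕ, dist x y ≤ lam ^ n * ε := by
    have : ∀ n : ℕ, dist x y ≤ lam ^ n * dist (f^[n] x) (f^[n] y) := by
      intro n
      induction n with
      | zero => simp
      | succ n ih =>
        have h := step _ _ (hxy n) (by simpa only [Function.iterate_succ_apply'] using hxy (n + 1))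
        rw [Function.iterate_succ_apply', Function.iterate_succ_apply', pow_succ, mul_assoc]
        exact ih.trans (mul_le_mul_of_nonneg_left h (pow_nonneg hf.lam_pos.le n))
    intro n
    exact (this n).trans (mul_le_mul_of_nonneg_left (hxy n) (pow_nonneg hf.lam_pos.le n))
  have hlim : Filter.Tendsto (fun n : ℕ => lam ^ n * ε) Filter.atTop (nhds 0) := by
    simpa using (tendsto_pow_atTop_nhds_zero_of_lt_one hf.lam_pos.le hf.lam_lt_one).mul_const ε
  exact dist_le_zero.mp (ge_of_tendsto' hlim hpow)

end Expanding

/-! ### Index sets of members with a common point -/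

section Overlaps

variable {K : Type*} {k : ℕ} {R : Fin k → Set K}

theorem mem_overlaps {s : Finset (Fin k)} {q : ℕ} :
    s ∈ overlaps R q ↔ s.card = q ∧ ∃ x, ∀ i ∈ s, x ∈ R i := by
  classical
  rw [overlaps, Finset.mem_filter, Finset.mem_powersetCard]
  simp [Set.Nonempty]

/-- Inclusion of `I_q` into all sets of `q` indices. -/
noncomputable def overlapsToPowersetCard {q : ℕ} (s : overlaps R q) :
    Set.powersetCard (Fin k) q :=
  ⟨s.1, card_of_mem_overlaps s⟩

theorem overlapElem_eq_enum {q : ℕ} (s : overlaps R q) :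
    overlapElem s = enum (overlapsToPowersetCard s) := by
  funext i
  rw [overlapElem, enum, Set.powersetCard.ofFinEmbEquiv_symm_apply]
  rfl

theorem overlapElem_mem {q : ℕ} (s : overlaps R q) (i : Fin q) : overlapElem s i ∈ s.1 := by
  rw [overlapElem_eq_enum]
  exact enum_mem (overlapsToPowersetCard s) i

theorem exists_overlapElem_eq {q : ℕ} (s : overlaps R q) {a : Fin k} (ha : a ∈ s.1) :
    ∃ i, overlapElem s i = a := by
  rw [overlapElem_eq_enum]
  exact exists_enum_eq (s := overlapsToPowersetCard s) ha

theorem overlaps_inter_nonempty {q : ℕ} (s : overlaps R q) (i j : Fin q) :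
    (R (overlapElem s i) ∩ R (overlapElem s j)).Nonempty := by
  obtain ⟨x, hx⟩ := (mem_overlaps.mp s.2).2
  exact ⟨x, hx _ (overlapElem_mem s i), hx _ (overlapElem_mem s j)⟩

end Overlaps

/-! ### Transitions in a Markov cover -/

section Cover

variable {K : Type*} [MetricSpace K] {f : K → K} {k : ℕ} {R : Fin k → Set K}

theorem transitionMatrix_eq_one_iff {i j : Fin k} :
    transitionMatrix f R i j = 1 ↔ (f '' interior (R i) ∩ interior (R j)).Nonempty := by
  simp [transitionMatrix]

theorem transitionMatrix_eq_zero_or_one (i j : Fin k) :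
    transitionMatrix f R i j = 0 ∨ transitionMatrix f R i j = 1 := by
  simp only [transitionMatrix, Matrix.of_apply]
  split_ifs <;> simp

theorem exists_perm_of_signedMatrix_ne_zero {q : ℕ} {s t : overlaps R q}
    (hst : signedMatrix f R q s t ≠ 0) : ∃ μ : Equiv.Perm (Fin q),
      ∀ i, transitionMatrix f R (overlapElem s i) (overlapElem t (μ i)) = 1 := by
  rw [signedMatrix, Matrix.of_apply] at hst
  split_ifs at hst with hex
  · exact ⟨_, hex.choose_spec.1⟩
  · exact absurd rfl hst

variable {δ : ℝ}

theorem IsMarkovCover.isClosed (h : IsMarkovCover f R δ) (i : Fin k) : IsClosed (R i) := by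
  rw [← h.proper i]
  exact isClosed_closure

theorem IsMarkovCover.exists_mem (h : IsMarkovCover f R δ) (x : K) : ∃ i, x ∈ R i := by
  have : x ∈ ⋃ i, R i := h.cover ▸ Set.mem_univ x
  simpa using this

theorem IsMarkovCover.dense (h : IsMarkovCover f R δ) : Dense (⋃ i, interior (R i)) := by
  rw [dense_iff_closure_eq, closure_iUnion_of_finite]
  simp_rw [h.proper, h.cover]

/-- Openness of `f` and density of the interiors give, arbitrarily near `x`, interior points of
members that map into the interior of `R j`; finiteness of the cover selects one member. -/
theorem IsMarkovCover.exists_pred (h : IsMarkovCover f R δ) (hc : Continuous f) (ho : IsOpenMap f)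
    {x : K} {j : Fin k} (hx : f x ∈ R j) : ∃ i, x ∈ R i ∧ transitionMatrix f R i j = 1 := by
  have hmem : x ∈ closure (⋃ i, interior (R i) ∩ f ⁻¹' interior (R j)) := by
    rw [mem_closure_iff]
    intro U hU hxU
    rw [← h.proper j, mem_closure_iff] at hx
    obtain ⟨_, ⟨u, huU, rfl⟩, hu⟩ := hx (f '' U) (ho U hU) ⟨x, hxU, rfl⟩
    obtain ⟨v, ⟨hvU, hvj⟩, hv⟩ := h.dense.inter_open_nonempty (U ∩ f ⁻¹' interior (R j))
      (hU.inter (isOpen_interior.preimage hc)) ⟨u, huU, hu⟩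
    obtain ⟨i, hi⟩ := Set.mem_iUnion.mp hv
    exact ⟨v, hvU, Set.mem_iUnion.mpr ⟨i, hi, hvj⟩⟩
  rw [closure_iUnion_of_finite] at hmem
  obtain ⟨i, hi⟩ := Set.mem_iUnion.mp hmem
  refine ⟨i, ?_, ?_⟩
  · rw [← h.proper i]
    exact closure_mono Set.inter_subset_left hi
  · obtain ⟨v, hv1, hv2⟩ := closure_nonempty_iff.mp ⟨x, hi⟩
    exact transitionMatrix_eq_one_iff.mpr ⟨f v, ⟨v, hv1, rfl⟩, hv2⟩

variable [CompactSpace K]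

theorem IsMarkovCover.dist_lt (h : IsMarkovCover f R δ) {i : Fin k} {x y : K} (hx : x ∈ R i)
    (hy : y ∈ R i) : dist x y < δ :=
  (Metric.dist_le_diam_of_mem Metric.isBounded_of_compactSpace hx hy).trans_lt (h.diam_lt i)

theorem IsMarkovCover.subset_image (h : IsMarkovCover f R δ) (hc : Continuous f) {i j : Fin k}
    (hij : transitionMatrix f R i j = 1) : R j ⊆ f '' R i := by
  have hcl : IsClosed (f '' R i) := ((h.isClosed i).isCompact.image hc).isClosed
  rw [← h.proper j]
  exact closure_minimal ((h.markov i j (transitionMatrix_eq_one_iff.mp hij)).trans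
    (Set.image_mono interior_subset)) hcl

variable {r lam c ε : ℝ}

theorem IsMarkovCover.eq_of_apply_eq (h : IsMarkovCover f R (min ε (c / 2)))
    (hf : IsRuelleExpandingWith f r lam c) {i j : Fin k} (hij : (R i ∩ R j).Nonempty) {x y : K}
    (hx : x ∈ R i) (hy : y ∈ R j) (hxy : f x = f y) : x = y := by
  obtain ⟨z, hzi, hzj⟩ := hij
  refine hf.eq_of_dist_le hxy ?_
  have h1 := (h.dist_lt hx hzi).trans_le (min_le_right _ _)
  have h2 := (h.dist_lt hzj hy).trans_le (min_le_right _ _)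
  linarith [dist_triangle x z y]

/-- An interior point of `R j` has a preimage in the interior of each of the two members. As these
meet and have diameter below `c / 2`, the preimages coincide, which disjointness of interiors
forbids for distinct members. -/
theorem IsMarkovCover.unique_pred (h : IsMarkovCover f R (min ε (c / 2)))
    (hf : IsRuelleExpandingWith f r lam c) {i i' j : Fin k} (hi : (R i ∩ R i').Nonempty)
    (h1 : transitionMatrix f R i j = 1) (h2 : transitionMatrix f R i' j = 1) : i = i' := by
  have h1' := transitionMatrix_eq_one_iff.mp h1
  obtain ⟨u, -, hu⟩ := h1'
  obtain ⟨v, hv, hvu⟩ := h.markov i j (transitionMatrix_eq_one_iff.mp h1) hu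
  obtain ⟨v', hv', hvu'⟩ := h.markov i' j (transitionMatrix_eq_one_iff.mp h2) hu
  have hvv : v = v' := h.eq_of_apply_eq hf hi (interior_subset hv) (interior_subset hv')
    (hvu.trans hvu'.symm)
  by_contra hne
  have := h.disjoint i i' hne
  rw [Set.eq_empty_iff_forall_notMem] at this
  exact this v ⟨hv, hvv ▸ hv'⟩

theorem IsMarkovCover.eq_of_iterates (h : IsMarkovCover f R (min ε (c / 2)))
    (hε : IsExpansivityConstant f ε) {x y : K}
    (hxy : ∀ n : ℕ, ∃ i, f^[n] x ∈ R i ∧ f^[n] y ∈ R i) : x = y := by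
  refine hε.2 x y fun n => ?_
  obtain ⟨i, hx, hy⟩ := hxy n
  exact ((h.dist_lt hx hy).trans_le (min_le_left _ _)).le

/-- Points with the same itinerary sets are equal, so there are finitely many of each period. -/
theorem IsMarkovCover.finite_ptsOfPeriod (h : IsMarkovCover f R (min ε (c / 2)))
    (hε : IsExpansivityConstant f ε) {n : ℕ} (hn : 1 ≤ n) : (Function.ptsOfPeriod f n).Finite := by
  let T : K → Fin n → Set (Fin k) := fun x j => {i | f^[j] x ∈ R i}
  refine Set.Finite.of_finite_image (f := T) (Set.toFinite _) fun x hx y hy hxy => ?_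
  refine h.eq_of_iterates hε fun m => ?_
  have hx' : Function.IsPeriodicPt f n x := hx
  have hy' : Function.IsPeriodicPt f n y := hy
  obtain ⟨i, hi⟩ := h.exists_mem (f^[m] x)
  refine ⟨i, hi, ?_⟩
  rw [← hx'.iterate_mod_apply] at hi
  rw [← hy'.iterate_mod_apply]
  have h1 : i ∈ T x ⟨m % n, Nat.mod_lt _ hn⟩ := hi
  rw [hxy] at h1
  exact h1

/-- Compared through inverses: each index in `t` has at most one predecessor in `s`, since the
members in `s` meet. -/
theorem IsMarkovCover.perm_unique (h : IsMarkovCover f R (min ε (c / 2)))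
    (hf : IsRuelleExpandingWith f r lam c) {q : ℕ} {s t : overlaps R q} {μ ν : Equiv.Perm (Fin q)}
    (hμ : ∀ i, transitionMatrix f R (overlapElem s i) (overlapElem t (μ i)) = 1)
    (hν : ∀ i, transitionMatrix f R (overlapElem s i) (overlapElem t (ν i)) = 1) : μ = ν := by
  have key : μ⁻¹ = ν⁻¹ := by
    ext1 j
    have h1 := hμ (μ⁻¹ j)
    have h2 := hν (ν⁻¹ j)
    rw [show μ (μ⁻¹ j) = j from μ.apply_symm_apply j] at h1
    rw [show ν (ν⁻¹ j) = j from ν.apply_symm_apply j] at h2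
    have h3 := h.unique_pred hf (overlaps_inter_nonempty s _ _) h1 h2
    rw [overlapElem_eq_enum] at h3
    exact enum_injective _ h3
  exact inv_injective key

/-- At most one term of the Leibniz expansion survives, and its value is the sign of the
permutation. -/
theorem IsMarkovCover.signedMatrix_eq_det (h : IsMarkovCover f R (min ε (c / 2)))
    (hf : IsRuelleExpandingWith f r lam c) {q : ℕ} (s t : overlaps R q) :
    signedMatrix f R q s t = (((transitionMatrix f R).map (Nat.cast : ℕ → ℂ)).submatrix
      (overlapElem s) (overlapElem t)).det := by
  rw [signedMatrix, Matrix.of_apply, ← Matrix.det_transpose, Matrix.det_apply']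
  have hprod : ∀ σ : Equiv.Perm (Fin q),
      ¬ (∀ i, transitionMatrix f R (overlapElem s i) (overlapElem t (σ i)) = 1) →
      ∏ i, (((transitionMatrix f R).map (Nat.cast : ℕ → ℂ)).submatrix
        (overlapElem s) (overlapElem t)).transpose (σ i) i = 0 := by
    intro σ hσ
    push Not at hσ
    obtain ⟨i, hi⟩ := hσ
    refine Finset.prod_eq_zero (Finset.mem_univ i) ?_
    simpa using (transitionMatrix_eq_zero_or_one _ _).resolve_right hi
  split_ifs with hex
  · have hμ := hex.choose_spec.1
    rw [Finset.sum_eq_single hex.choose]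
    · rw [Finset.prod_eq_one, mul_one]
      intro i _
      simp [hμ i]
    · intro σ _ hσ
      rw [hprod σ fun h' => hσ (h.perm_unique hf h' hμ), mul_zero]
    · simp
  · symm
    refine Finset.sum_eq_zero fun σ _ => ?_
    rw [hprod σ fun h' => hex ⟨σ, h', fun τ hτ => h.perm_unique hf hτ h'⟩, mul_zero]

/-- The permutation provides a preimage of `y` in each member of `s`; the members meet and are
small, so all these preimages are one point. -/
theorem IsMarkovCover.exists_preimage (h : IsMarkovCover f R (min ε (c / 2)))
    (hf : IsRuelleExpandingWith f r lam c) {q : ℕ} (hq : 1 ≤ q) {s t : overlaps R q}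
    (hst : signedMatrix f R q s t ≠ 0) {y : K} (hy : ∀ i ∈ t.1, y ∈ R i) :
    ∃ x, f x = y ∧ ∀ i ∈ s.1, x ∈ R i := by
  obtain ⟨μ, hμ⟩ := exists_perm_of_signedMatrix_ne_zero hst
  have hex : ∀ i, ∃ x ∈ R (overlapElem s i), f x = y := fun i =>
    h.subset_image hf.continuous (hμ i) (hy _ (overlapElem_mem t (μ i)))
  choose x hx hxy using hex
  let i₀ : Fin q := ⟨0, hq⟩
  refine ⟨x i₀, hxy i₀, fun a ha => ?_⟩
  obtain ⟨i, rfl⟩ := exists_overlapElem_eq s ha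
  have : x i₀ = x i := h.eq_of_apply_eq hf (overlaps_inter_nonempty s i₀ i) (hx i₀) (hx i)
    ((hxy i₀).trans (hxy i).symm)
  rw [this]
  exact hx i

/-- An infinite path of non-vanishing entries of the signed matrix is followed by a point. -/
theorem IsMarkovCover.exists_following (h : IsMarkovCover f R (min ε (c / 2)))
    (hf : IsRuelleExpandingWith f r lam c) {q : ℕ} (hq : 1 ≤ q) (w : ℕ → overlaps R q)
    (hw : ∀ j, signedMatrix f R q (w j) (w (j + 1)) ≠ 0) :
    ∃ x, ∀ j, ∀ i ∈ (w j).1, f^[j] x ∈ R i := by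
  let F : ℕ → Set K := fun n => {x | ∀ j ≤ n, ∀ i ∈ (w j).1, f^[j] x ∈ R i}
  -- The path is quantified anew because the induction pulls back a point following the shifted
  -- path.
  have hfin : ∀ n (w : ℕ → overlaps R q),
      (∀ j, signedMatrix f R q (w j) (w (j + 1)) ≠ 0) →
      ∃ x, ∀ j ≤ n, ∀ i ∈ (w j).1, f^[j] x ∈ R i := by
    intro n
    induction n with
    | zero =>
      intro w _
      obtain ⟨x, hx⟩ := (mem_overlaps.mp (w 0).2).2
      refine ⟨x, fun j hj i hi => ?_⟩
      obtain rfl : j = 0 := by omega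
      exact hx i hi
    | succ n ih =>
      intro w hw
      obtain ⟨y, hy⟩ := ih (fun j => w (j + 1)) fun j => hw (j + 1)
      obtain ⟨x, hxy, hx⟩ := h.exists_preimage hf hq (hw 0) (hy 0 (Nat.zero_le n))
      refine ⟨x, fun j hj i hi => ?_⟩
      cases j with
      | zero => exact hx i hi
      | succ j =>
        rw [Function.iterate_succ_apply, hxy]
        exact hy j (by omega) i hi
  have hclosed : ∀ n, IsClosed (F n) := by
    intro n
    simp only [F, Set.ofPred_forall]
    exact isClosed_iInter fun j => isClosed_iInter fun _ => isClosed_iInter fun i =>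
      isClosed_iInter fun _ => (h.isClosed i).preimage (hf.continuous.iterate j)
  obtain ⟨x, hx⟩ := IsCompact.nonempty_iInter_of_sequence_nonempty_isCompact_isClosed F
    (fun n x hx j hj => hx j (by omega)) (fun n => hfin n w hw) (hclosed 0).isCompact hclosed
  exact ⟨x, fun j => Set.mem_iInter.mp hx j j le_rfl⟩

end Cover

/-! ### Counting periodic points by traces -/

section Counting

variable {K : Type*} [MetricSpace K] {f : K → K} {k : ℕ} {R : Fin k → Set K}

open Classical in
/-- The transitions allowed along the orbit step `x ↦ f x`. -/
noncomputable def localMatrix (f : K → K) (R : Fin k → Set K) (x : K) :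
    Matrix (Fin k) (Fin k) ℂ :=
  Matrix.of fun i j => if x ∈ R i ∧ f x ∈ R j then (transitionMatrix f R i j : ℂ) else 0

/-- The product of the local matrices along an orbit segment of length `n`. -/
noncomputable def orbitMatrix (f : K → K) (R : Fin k → Set K) (n : ℕ) (x : K) :
    Matrix (Fin k) (Fin k) ℂ :=
  (List.ofFn fun j : Fin n => localMatrix f R (f^[j] x)).prod

open Classical in
/-- The indicator vector of the members of the cover that contain `x`. -/
noncomputable def memberVector (R : Fin k → Set K) (x : K) : Fin k → ℂ :=
  fun i => if x ∈ R i then 1 else 0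

open Classical in
-- An index whose member misses `x` or `f x` produces a zero row or column, which kills the minor.
theorem compound_localMatrix (x : K) {q : ℕ} (s t : Set.powersetCard (Fin k) q) :
    compound q (localMatrix f R x) s t =
      if (∀ i ∈ s.1, x ∈ R i) ∧ (∀ i ∈ t.1, f x ∈ R i) then
        (((transitionMatrix f R).map (Nat.cast : ℕ → ℂ)).submatrix (enum s) (enum t)).det
      else 0 := by
  rw [compound, Matrix.of_apply]
  split_ifs with hmem
  · congr 1
    ext i j
    simp [localMatrix, hmem.1 _ (enum_mem s i), hmem.2 _ (enum_mem t j)]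
  · rw [not_and_or] at hmem
    push Not at hmem
    rcases hmem with ⟨a, ha, hxa⟩ | ⟨a, ha, hxa⟩
    · obtain ⟨i, rfl⟩ := exists_enum_eq ha
      exact Matrix.det_eq_zero_of_row_eq_zero i fun j => by simp [localMatrix, hxa]
    · obtain ⟨j, rfl⟩ := exists_enum_eq ha
      exact Matrix.det_eq_zero_of_column_eq_zero j fun i => by simp [localMatrix, hxa]

variable [CompactSpace K] {r lam c ε : ℝ}

/-- For `f x ∈ R j` exactly one summand is non-zero: `exists_pred` supplies the predecessor
containing `x`, and `unique_pred` excludes a second. -/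
theorem IsMarkovCover.vecMul_localMatrix (h : IsMarkovCover f R (min ε (c / 2)))
    (hf : IsRuelleExpandingWith f r lam c) (x : K) :
    Matrix.vecMul (memberVector R x) (localMatrix f R x) = memberVector R (f x) := by
  funext j
  simp only [Matrix.vecMul, dotProduct, memberVector, localMatrix, Matrix.of_apply]
  split_ifs with hj
  · obtain ⟨i, hi, hij⟩ := h.exists_pred hf.continuous hf.isOpenMap hj
    rw [Finset.sum_eq_single i]
    · simp [hi, hj, hij]
    · intro b _ hb
      by_cases hxb : x ∈ R b
      · have : transitionMatrix f R b j = 0 :=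
          (transitionMatrix_eq_zero_or_one b j).resolve_right fun hbj =>
            hb (h.unique_pred hf ⟨x, hxb, hi⟩ hbj hij)
        simp [this]
      · simp [hxb]
    · simp
  · exact Finset.sum_eq_zero fun i _ => by simp [hj]

theorem IsMarkovCover.vecMul_orbitMatrix (h : IsMarkovCover f R (min ε (c / 2)))
    (hf : IsRuelleExpandingWith f r lam c) (n : ℕ) (x : K) :
    Matrix.vecMul (memberVector R x) (orbitMatrix f R n x) = memberVector R (f^[n] x) := by
  induction n generalizing x with
  | zero => simp [orbitMatrix]
  | succ n ih =>
    have : orbitMatrix f R (n + 1) x = localMatrix f R x * orbitMatrix f R n (f x) := by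
      simp [orbitMatrix, List.ofFn_succ]
    rw [this, ← Matrix.vecMul_vecMul, h.vecMul_localMatrix hf, ih, Function.iterate_succ_apply]

theorem IsMarkovCover.sum_trace_compound_orbitMatrix (h : IsMarkovCover f R (min ε (c / 2)))
    (hf : IsRuelleExpandingWith f r lam c) {n : ℕ} {x : K} (hx : f^[n] x = x) :
    ∑ q ∈ Finset.Icc 1 k, (-1) ^ (q + 1) * (compound q (orbitMatrix f R n x)).trace = 1 := by
  refine sum_trace_compound_eq_one (u := memberVector R x) (fun h0 => ?_) ?_
  · obtain ⟨i, hi⟩ := h.exists_mem x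
    have := congrFun h0 i
    simp [memberVector, hi] at this
  · rw [h.vecMul_orbitMatrix hf, hx]

/-- A closed path of non-vanishing entries of the signed matrix is followed by exactly one periodic
point. -/
theorem IsMarkovCover.existsUnique_periodic (h : IsMarkovCover f R (min ε (c / 2)))
    (hf : IsRuelleExpandingWith f r lam c) (hε : IsExpansivityConstant f ε) {q n : ℕ} (hq : 1 ≤ q)
    (hn : 1 ≤ n) (w : Fin (n + 1) → overlaps R q) (hcl : w 0 = w (Fin.last n))
    (hw : ∀ j : Fin n, signedMatrix f R q (w j.castSucc) (w j.succ) ≠ 0) :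
    ∃! x, x ∈ Function.ptsOfPeriod f n ∧ ∀ j : Fin (n + 1), ∀ i ∈ (w j).1, f^[j] x ∈ R i := by
  have hlt : ∀ j, j % n < n := fun j => Nat.mod_lt _ hn
  -- The closed path is repeated periodically; `hcl` handles the wrap from `n - 1` to `0`.
  let v : ℕ → overlaps R q := fun j => w (Fin.castSucc ⟨j % n, hlt j⟩)
  have hsucc : ∀ j, v (j + 1) = w (Fin.succ ⟨j % n, hlt j⟩) := by
    intro j
    by_cases hj : j % n + 1 < n
    · have : (j + 1) % n = j % n + 1 := by
        rw [← Nat.mod_add_mod, Nat.mod_eq_of_lt hj]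
      simp only [v, this]
      rfl
    · have h1 : j % n + 1 = n := by have := hlt j; omega
      have h2 : (j + 1) % n = 0 := by rw [← Nat.mod_add_mod, h1, Nat.mod_self]
      have h3 : Fin.succ ⟨j % n, hlt j⟩ = Fin.last n := Fin.ext h1
      rw [h3, ← hcl]
      simp only [v, h2]
      rfl
  have hv : ∀ j, signedMatrix f R q (v j) (v (j + 1)) ≠ 0 := fun j => by
    rw [hsucc]
    exact hw _
  have hvn : ∀ j, v (j + n) = v j := fun j => by simp [v]
  have hmem : ∀ j, ∃ i, i ∈ (v j).1 := fun j => ⟨_, overlapElem_mem (v j) ⟨0, hq⟩⟩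
  obtain ⟨x, hx⟩ := h.exists_following hf hq v hv
  -- The point and its `n`-th image follow the same periodic path, so expansivity identifies them.
  have hper : f^[n] x = x := by
    refine h.eq_of_iterates hε fun j => ?_
    obtain ⟨i, hi⟩ := hmem j
    refine ⟨i, ?_, hx j i hi⟩
    rw [← Function.iterate_add_apply]
    exact hx (j + n) i (by rwa [hvn])
  have hcompat : ∀ y, (∀ j : Fin (n + 1), ∀ i ∈ (w j).1, f^[j] y ∈ R i) → f^[n] y = y →
      ∀ j, ∀ i ∈ (v j).1, f^[j] y ∈ R i := by
    intro y hy hyp j i hi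
    rw [← Function.IsPeriodicPt.iterate_mod_apply (show Function.IsPeriodicPt f n y from hyp)]
    exact hy (Fin.castSucc ⟨j % n, hlt j⟩) i hi
  refine ⟨x, ⟨hper, fun j i hi => ?_⟩, ?_⟩
  · induction j using Fin.lastCases with
    | last =>
      rw [Fin.val_last, hper]
      rw [← hcl] at hi
      exact hx 0 i (by simpa [v] using! hi)
    | cast j =>
      refine hx j i ?_
      have : v j = w j.castSucc := by
        simp only [v, Nat.mod_eq_of_lt j.2]
      rwa [this]
  · rintro y ⟨hy1, hy2⟩
    refine h.eq_of_iterates hε fun j => ?_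
    obtain ⟨i, hi⟩ := hmem j
    exact ⟨i, hcompat y hy2 hy1 j i hi, hx j i hi⟩

/-- Both sides are sums over closed paths: the weight of a path on the left is assigned to the only
periodic point following it, and on the right the minors along the orbit of `x` vanish off the paths
that `x` follows. -/
theorem IsMarkovCover.trace_signedMatrix_pow (h : IsMarkovCover f R (min ε (c / 2)))
    (hf : IsRuelleExpandingWith f r lam c) (hε : IsExpansivityConstant f ε) {q n : ℕ} (hq : 1 ≤ q)
    (hn : 1 ≤ n) :
    (signedMatrix f R q ^ n).trace = ∑ x ∈ (h.finite_ptsOfPeriod hε hn).toFinset,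
      (compound q (orbitMatrix f R n x)).trace := by
  classical
  let follows : K → (Fin (n + 1) → overlaps R q) → Prop := fun x w =>
    ∀ j : Fin (n + 1), ∀ i ∈ (w j).1, f^[j] x ∈ R i
  let weight : (Fin (n + 1) → overlaps R q) → ℂ := fun w =>
    if w 0 = w (Fin.last n) then ∏ j : Fin n, signedMatrix f R q (w j.castSucc) (w j.succ) else 0
  have hpow : signedMatrix f R q ^ n = (List.ofFn fun _ : Fin n => signedMatrix f R q).prod := by
    rw [List.ofFn_const, List.prod_replicate]
  have hsplit : ∀ w, weight w = ∑ x ∈ (h.finite_ptsOfPeriod hε hn).toFinset,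
      if follows x w then weight w else 0 := by
    intro w
    by_cases hw0 : weight w = 0
    · simp [hw0]
    · have hcl : w 0 = w (Fin.last n) := by
        by_contra hne
        exact hw0 (if_neg hne)
      have hprod : ∏ j : Fin n, signedMatrix f R q (w j.castSucc) (w j.succ) ≠ 0 := by
        simpa [weight, hcl] using hw0
      obtain ⟨x, ⟨hx1, hx2⟩, hx3⟩ := h.existsUnique_periodic hf hε hq hn w hcl
        fun j => Finset.prod_ne_zero_iff.mp hprod j (Finset.mem_univ j)
      rw [Finset.sum_eq_single x]
      · rw [if_pos (show follows x w from hx2)]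
      · intro y hy hyx
        exact if_neg fun hyw => hyx (hx3 y ⟨(Set.Finite.mem_toFinset _).mp hy, hyw⟩)
      · intro hx
        exact absurd ((Set.Finite.mem_toFinset _).mpr hx1) hx
  rw [hpow, trace_list_ofFn_prod]
  change ∑ w, weight w = _
  rw [Finset.sum_congr rfl fun w _ => hsplit w, Finset.sum_comm]
  refine Finset.sum_congr rfl fun x _ => ?_
  rw [orbitMatrix, compound_list_prod, List.map_ofFn, trace_list_ofFn_prod]
  -- The right side runs over all `q`-element index sets. A non-zero product puts the orbit points
  -- in all the members chosen, so only paths in `I_q` contribute.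
  refine Fintype.sum_of_injective (fun w j => overlapsToPowersetCard (w j)) ?_ _ _ ?_ ?_
  · intro w w' hww
    funext j
    have := congrArg Subtype.val (congrFun hww j)
    exact Subtype.ext this
  · intro w hw
    by_contra hne
    refine hw ?_
    have hcl : w 0 = w (Fin.last n) := by
      by_contra hne'
      exact hne (if_neg hne')
    rw [if_pos hcl] at hne
    have hj : ∀ j : Fin n, (w j.castSucc).1 ∈ overlaps R q := by
      intro j
      have := Finset.prod_ne_zero_iff.mp hne j (Finset.mem_univ j)
      rw [Function.comp_apply, compound_localMatrix] at this
      have h' := (ite_ne_right_iff.mp this).1.1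
      exact mem_overlaps.mpr ⟨(w j.castSucc).2, _, h'⟩
    have hall : ∀ j, (w j).1 ∈ overlaps R q := by
      intro j
      induction j using Fin.lastCases with
      | last =>
        rw [← hcl]
        exact hj ⟨0, hn⟩
      | cast j => exact hj j
    exact ⟨fun j => ⟨(w j).1, hall j⟩, rfl⟩
  · intro w
    have hcl : (overlapsToPowersetCard (w 0) = overlapsToPowersetCard (w (Fin.last n))) ↔
        w 0 = w (Fin.last n) := by
      constructor
      · intro h'
        have := congrArg Subtype.val h'
        exact Subtype.ext this
      · exact fun h' => congrArg _ h'
    simp only [Function.comp_apply, compound_localMatrix, hcl, weight]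
    by_cases hw : w 0 = w (Fin.last n)
    · simp only [hw, if_true]
      split_ifs with hfol
      · refine Finset.prod_congr rfl fun j _ => ?_
        rw [if_pos, h.signedMatrix_eq_det hf, overlapElem_eq_enum, overlapElem_eq_enum]
        refine ⟨hfol j.castSucc, ?_⟩
        have := hfol j.succ
        rwa [Fin.val_succ, Function.iterate_succ_apply'] at this
      · symm
        by_contra hne
        refine hfol ?_
        have hcast : ∀ j : Fin n, ∀ i ∈ (w j.castSucc).1, f^[j] x ∈ R i := fun j =>
          (ite_ne_right_iff.mp (Finset.prod_ne_zero_iff.mp hne j (Finset.mem_univ j))).1.1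
        have hsucc : ∀ j : Fin n, ∀ i ∈ (w j.succ).1, f (f^[j] x) ∈ R i := fun j =>
          (ite_ne_right_iff.mp (Finset.prod_ne_zero_iff.mp hne j (Finset.mem_univ j))).1.2
        intro j
        induction j using Fin.cases with
        | zero => exact hcast ⟨0, hn⟩
        | succ j =>
          rw [Fin.val_succ, Function.iterate_succ_apply']
          exact hsucc j
    · simp [hw]

theorem IsMarkovCover.periodicCount_eq (h : IsMarkovCover f R (min ε (c / 2)))
    (hf : IsRuelleExpandingWith f r lam c) (hε : IsExpansivityConstant f ε) {n : ℕ} (hn : 1 ≤ n) :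
    (periodicCount f n : ℂ) =
      ∑ q ∈ Finset.Icc 1 k, (-1) ^ (q + 1) * (signedMatrix f R q ^ n).trace := by
  have h1 : ∀ q ∈ Finset.Icc 1 k, (-1) ^ (q + 1) * (signedMatrix f R q ^ n).trace =
      ∑ x ∈ (h.finite_ptsOfPeriod hε hn).toFinset,
        (-1) ^ (q + 1) * (compound q (orbitMatrix f R n x)).trace := fun q hq => by
    rw [h.trace_signedMatrix_pow hf hε (Finset.mem_Icc.mp hq).1 hn, Finset.mul_sum]
  rw [Finset.sum_congr rfl h1, Finset.sum_comm, periodicCount,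
    Set.ncard_eq_toFinset_card _ (h.finite_ptsOfPeriod hε hn), Finset.cast_card]
  refine Finset.sum_congr rfl fun x hx => (h.sum_trace_compound_orbitMatrix hf ?_).symm
  exact (Set.Finite.mem_toFinset (h.finite_ptsOfPeriod hε hn)).mp hx

end Counting

/-! ### From a cover with images that are unions of members to a Markov cover -/

section Atoms

variable {K E : Type*} [MetricSpace K] {f : K → K} {P : E → Set K} {W : E → Set E} {η : ℝ}

/-- The points in the interior of `P e` for `e ∈ I` and outside of `P e` for all other `e`. -/
def atom (P : E → Set K) (I : Set E) : Set K :=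
  {x | (∀ e ∈ I, x ∈ interior (P e)) ∧ ∀ e ∉ I, x ∉ P e}

theorem isOpen_atom [Finite E] (hP : ∀ e, IsClosed (P e)) (I : Set E) : IsOpen (atom P I) := by
  have : atom P I = (⋂ e ∈ I, interior (P e)) ∩ ⋂ e ∈ Iᶜ, (P e)ᶜ := by
    ext x
    simp [atom]
  rw [this]
  exact ((Set.toFinite I).isOpen_biInter fun e _ => isOpen_interior).inter
    ((Set.toFinite Iᶜ).isOpen_biInter fun e _ => (hP e).isOpen_compl)

theorem disjoint_atom {I J : Set E} (hIJ : I ≠ J) : Disjoint (atom P I) (atom P J) := by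
  rw [Set.disjoint_left]
  rintro x ⟨h1, h2⟩ ⟨h3, h4⟩
  refine hIJ (Set.ext fun e => ⟨fun he => ?_, fun he => ?_⟩)
  · by_contra hne
    exact h4 e hne (interior_subset (h1 e he))
  · by_contra hne
    exact h2 e hne (interior_subset (h3 e he))

theorem mem_of_mem_atom {I : Set E} {x : K} {e : E} (hx : x ∈ atom P I) (he : x ∈ P e) : e ∈ I := by
  by_contra hne
  exact hx.2 e hne he

theorem closure_atom_subset (hP : ∀ e, IsClosed (P e)) {I : Set E} {e : E} (he : e ∈ I) :
    closure (atom P I) ⊆ P e :=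
  closure_minimal (fun _ hx => interior_subset (hx.1 e he)) (hP e)

/-- Frontiers of closed sets have empty interior, so the points off all frontiers are dense; each of
them lies in the atom of its membership pattern. -/
theorem iUnion_closure_atom [CompactSpace K] [Finite E] (hP : ∀ e, IsClosed (P e)) :
    ⋃ I, closure (atom P I) = Set.univ := by
  have hd : Dense (⋂ e, (frontier (P e))ᶜ) := by
    refine dense_iInter_of_isOpen (fun e => isClosed_frontier.isOpen_compl) fun e => ?_
    rw [← interior_eq_empty_iff_dense_compl]
    exact interior_frontier (hP e)
  have hsub : ⋂ e, (frontier (P e))ᶜ ⊆ ⋃ I, atom P I := by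
    intro x hx
    refine Set.mem_iUnion.mpr ⟨{e | x ∈ P e}, fun e he => ?_, fun e he => he⟩
    by_contra hne
    refine Set.mem_iInter.mp hx e ?_
    rw [(hP e).frontier_eq]
    exact ⟨he, hne⟩
  rw [← closure_iUnion_of_finite]
  exact (hd.mono hsub).closure_eq

theorem dist_le_of_mem_closure_atom (hP : ∀ e, IsClosed (P e)) (hcov : ⋃ e, P e = Set.univ)
    (hη : ∀ e, ∀ x ∈ P e, ∀ y ∈ P e, dist x y ≤ η) {I : Set E} {x y : K}
    (hx : x ∈ closure (atom P I)) (hy : y ∈ closure (atom P I)) : dist x y ≤ η := by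
  obtain ⟨z, hz⟩ := closure_nonempty_iff.mp ⟨x, hx⟩
  obtain ⟨e, he⟩ := Set.mem_iUnion.mp (hcov ▸ Set.mem_univ z : z ∈ ⋃ e, P e)
  have heI := mem_of_mem_atom hz he
  exact hη e x (closure_atom_subset hP heI hx) y (closure_atom_subset hP heI hy)

variable {r lam c : ℝ}

theorem IsRuelleExpandingWith.exists_preimage_near (hf : IsRuelleExpandingWith f r lam c)
    {x y : K} (hxy : dist y (f x) ≤ η) (hηr : η < r) : ∃ z, f z = y ∧ dist z x ≤ η := by
  obtain ⟨φ, h0, h1, h2⟩ := hf.exists_branch (f x) x rfl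
  have hy : y ∈ Metric.ball (f x) r := Metric.mem_ball.mpr (hxy.trans_lt hηr)
  have h3 := h2 y hy (f x) (Metric.mem_ball_self hf.r_pos)
  rw [h0] at h3
  refine ⟨φ y, h1 y hy, h3.trans ?_⟩
  nlinarith [hf.lam_pos, hf.lam_lt_one, dist_nonneg (x := y) (y := f x)]

variable (hf : IsRuelleExpandingWith f r lam c) (hP : ∀ e, IsClosed (P e))
  (hcov : ⋃ e, P e = Set.univ) (hη : ∀ e, ∀ x ∈ P e, ∀ y ∈ P e, dist x y ≤ η) (hη0 : 0 < η)
  (hηr : η < r) (hηc : 4 * η ≤ c) (himg : ∀ e, f '' P e = ⋃ l ∈ W e, P l)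

include hf hP hcov hη hη0 hηr hηc himg

/-- The preimage `z` of `y` near `x` has the membership pattern of `x`: `y` and `f x` lie in the
same sets `P l`, whose unions are the images of the `P e`, and preimages at most `c` apart coincide.
-/
theorem atom_subset_image {I J : Set E} {x : K} (hx : x ∈ atom P I) (hfx : f x ∈ atom P J) :
    atom P J ⊆ f '' atom P I := by
  intro y hy
  obtain ⟨z, hzy, hzx⟩ := hf.exists_preimage_near (dist_le_of_mem_closure_atom hP hcov hη
    (subset_closure hy) (subset_closure hfx)) hηr
  refine ⟨z, ⟨fun e he => ?_, fun e he hze => ?_⟩, hzy⟩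
  · have hxe : x ∈ P e := interior_subset (hx.1 e he)
    have h1 : f x ∈ ⋃ l ∈ W e, P l := himg e ▸ ⟨x, hxe, rfl⟩
    simp only [Set.mem_iUnion] at h1
    obtain ⟨l, hl, hfl⟩ := h1
    have hlJ := mem_of_mem_atom hfx hfl
    rw [mem_interior]
    refine ⟨f ⁻¹' interior (P l) ∩ Metric.ball z η, ?_,
      (isOpen_interior.preimage hf.continuous).inter Metric.isOpen_ball,
      ⟨by rw [Set.mem_preimage, hzy]; exact hy.1 l hlJ, Metric.mem_ball_self hη0⟩⟩
    rintro w ⟨hw1, hw2⟩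
    have h2 : f w ∈ f '' P e := by
      rw [himg e]
      exact Set.mem_biUnion hl (interior_subset hw1)
    obtain ⟨p, hp, hpw⟩ := h2
    -- Going from `p` to `w` through `x` and `z` costs at most `3 * η`, which is below `c`.
    have : p = w := by
      refine hf.eq_of_dist_le hpw ?_
      have h3 := hη e p hp x hxe
      have h4 := Metric.mem_ball.mp hw2
      rw [dist_comm] at h4 hzx
      linarith [dist_triangle4 p x z w]
    rwa [← this]
  · have h1 : f z ∈ ⋃ l ∈ W e, P l := himg e ▸ ⟨z, hze, rfl⟩
    simp only [Set.mem_iUnion, hzy] at h1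
    obtain ⟨l, hl, hyl⟩ := h1
    have hlJ := mem_of_mem_atom hy hyl
    have h2 : f x ∈ f '' P e := by
      rw [himg e]
      exact Set.mem_biUnion hl (interior_subset (hfx.1 l hlJ))
    obtain ⟨p, hp, hpx⟩ := h2
    have : p = x := by
      refine hf.eq_of_dist_le hpx ?_
      linarith [dist_triangle p z x, hη e p hp z hze]
    exact hx.2 e he (this ▸ hp)

variable [Finite E]

/-- Openness of `f` first turns the hypothesis into a transition between the atoms themselves. Near
the chosen preimage `z`, density of `atom P J` and local uniqueness of preimages then yield points
of `atom P I` arbitrarily close to every `w`. -/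
theorem interior_closure_atom_subset_image {I J : Set E}
    (hIJ : (f '' interior (closure (atom P I)) ∩ interior (closure (atom P J))).Nonempty) :
    interior (closure (atom P J)) ⊆ f '' interior (closure (atom P I)) := by
  have hdist {I : Set E} {x y : K} (hx : x ∈ closure (atom P I)) (hy : y ∈ closure (atom P I)) :
      dist x y ≤ η := dist_le_of_mem_closure_atom hP hcov hη hx hy
  obtain ⟨x, hx, hfx⟩ : ∃ x ∈ atom P I, f x ∈ atom P J := by
    obtain ⟨_, ⟨v, hv, rfl⟩, hfv⟩ := hIJ
    obtain ⟨u, ⟨-, hu⟩, huI⟩ := mem_closure_iff.mp (interior_subset hv)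
      (interior (closure (atom P I)) ∩ f ⁻¹' interior (closure (atom P J)))
      (isOpen_interior.inter (isOpen_interior.preimage hf.continuous)) ⟨hv, hfv⟩
    obtain ⟨_, ⟨x, hx, rfl⟩, hfx⟩ := mem_closure_iff.mp (interior_subset hu) (f '' atom P I)
      (hf.isOpenMap _ (isOpen_atom hP I)) ⟨u, huI, rfl⟩
    exact ⟨x, hx, hfx⟩
  have hsub := atom_subset_image hf hP hcov hη hη0 hηr hηc himg hx hfx
  intro y hy
  obtain ⟨z, hzy, hzx⟩ := hf.exists_preimage_near
    (hdist (interior_subset hy) (subset_closure hfx)) hηr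
  refine ⟨z, ?_, hzy⟩
  have hVo : IsOpen (f ⁻¹' interior (closure (atom P J)) ∩ Metric.ball z η) :=
    (isOpen_interior.preimage hf.continuous).inter Metric.isOpen_ball
  rw [mem_interior]
  refine ⟨_, ?_, hVo, ⟨by rwa [Set.mem_preimage, hzy], Metric.mem_ball_self hη0⟩⟩
  intro w hw
  rw [mem_closure_iff]
  intro U hU hwU
  obtain ⟨_, ⟨u, ⟨huU, -, huz⟩, rfl⟩, hfu⟩ := mem_closure_iff.mp (interior_subset hw.1)
    (f '' (U ∩ (f ⁻¹' interior (closure (atom P J)) ∩ Metric.ball z η)))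
    (hf.isOpenMap _ (hU.inter hVo)) ⟨w, ⟨hwU, hw⟩, rfl⟩
  obtain ⟨v, hv, hvu⟩ := hsub hfu
  have : v = u := by
    refine hf.eq_of_dist_le hvu ?_
    have h1 := hdist (subset_closure hv) (subset_closure hx)
    have h2 := Metric.mem_ball.mp huz
    rw [dist_comm] at h2 hzx
    linarith [dist_triangle4 v x z u]
  exact ⟨u, huU, this ▸ hv⟩

/-- The closures of the atoms of a cover by small closed sets, whose images are unions of members,
form a Markov cover. -/
theorem exists_isMarkovCover_of_cover [CompactSpace K] {δ : ℝ} (hηδ : η < δ) :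
    ∃ (k : ℕ) (R : Fin k → Set K), IsMarkovCover f R δ := by
  classical
  have := Fintype.ofFinite E
  let e := Fintype.equivFin (Set E)
  -- All subsets of `E` serve as indices; an empty atom is harmless, as the empty set meets every
  -- condition.
  refine ⟨_, fun i => closure (atom P (e.symm i)), ?_, fun i => ?_, fun i => ?_,
    fun i j hij => ?_, fun i j hij => ?_⟩
  · rw [← iUnion_closure_atom hP]
    exact e.symm.surjective.iUnion_comp fun I => closure (atom P I)
  · exact (Metric.diam_le_of_forall_dist_le hη0.le fun x hx y hy =>
      dist_le_of_mem_closure_atom hP hcov hη hx hy).trans_lt hηδ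
  · refine (closure_minimal interior_subset isClosed_closure).antisymm (closure_mono ?_)
    exact interior_maximal subset_closure (isOpen_atom hP _)
  · have hd := disjoint_atom (P := P) fun h => hij (e.symm.injective h)
    have h1 := hd.closure_right (isOpen_atom hP _)
    have h2 := (h1.mono_right interior_subset).closure_left isOpen_interior
    exact (h2.mono_left interior_subset).inter_eq
  · exact interior_closure_atom_subset_image hf hP hcov hη hη0 hηr hηc himg hij

end Atoms

/-! ### Shadowing sets and the existence of Markov covers -/

section Net

variable {K : Type*} [MetricSpace K] {f : K → K} {r lam c : ℝ}

/-- The operator on families of sets indexed by a net whose greatest fixed point consists of the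
points that are `β`-shadowed by an `α`-pseudo-orbit in the net. -/
def shadowOperator (f : K → K) (t : Set K) (α β : ℝ) : (t → Set K) →o (t → Set K) where
  toFun Q e := {x | dist x e ≤ β ∧ ∃ l : t, dist (f e) l ≤ α ∧ f x ∈ Q l}
  monotone' _ _ hQ _ _ := fun ⟨h1, l, h2, h3⟩ => ⟨h1, l, h2, hQ l h3⟩

/-- The points `β`-shadowed by an `α`-pseudo-orbit in the net `t` that starts at a given point. -/
def shadowed (f : K → K) (t : Set K) (α β : ℝ) : t → Set K :=
  (shadowOperator f t α β).gfp

theorem mem_shadowed {t : Set K} {α β : ℝ} {e : t} {x : K} :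
    x ∈ shadowed f t α β e ↔
      dist x e ≤ β ∧ ∃ l : t, dist (f e) l ≤ α ∧ f x ∈ shadowed f t α β l := by
  have h : shadowed f t α β = shadowOperator f t α β (shadowed f t α β) :=
    (OrderHom.map_gfp (shadowOperator f t α β)).symm
  rw [h]
  conv_rhs => rw [← h]
  rfl

/-- The closures again lie below their image under the operator, finiteness of `t` letting closure
pass through the union over `l`; so they lie below the greatest fixed point. -/
theorem isClosed_shadowed (hf : Continuous f) {t : Set K} (ht : t.Finite) {α β : ℝ} (e : t) :
    IsClosed (shadowed f t α β e) := by
  have := ht.to_subtype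
  refine isClosed_of_closure_subset ?_
  have hle : (fun e => closure (shadowed f t α β e)) ≤
      shadowOperator f t α β fun e => closure (shadowed f t α β e) := by
    intro e x hx
    refine ⟨?_, ?_⟩
    · exact closure_minimal (fun y hy => (mem_shadowed.mp hy).1)
        (isClosed_le (continuous_id.dist continuous_const) continuous_const) hx
    · have h1 : f x ∈ closure (⋃ l : t, ⋃ _ : dist (f e) l ≤ α, shadowed f t α β l) := by
        refine map_mem_closure hf hx fun y hy => ?_
        obtain ⟨-, l, hl, hyl⟩ := mem_shadowed.mp hy
        exact Set.mem_iUnion₂.mpr ⟨l, hl, hyl⟩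
      simp only [closure_iUnion_of_finite] at h1
      obtain ⟨l, hl, hxl⟩ := Set.mem_iUnion₂.mp h1
      exact ⟨l, hl, hxl⟩
  exact (OrderHom.le_gfp _ hle) e

/-- With `α = (1 - lam) * β`, a point shadowed from `l` is within `(2 - lam) * β < r` of `f e`. The
branch at `e` brings it within `lam * (2 - lam) * β ≤ β` of `e`, because `(1 - lam)^2 ≥ 0`. -/
theorem IsRuelleExpandingWith.image_shadowed (hf : IsRuelleExpandingWith f r lam c) {t : Set K}
    {β : ℝ} (hβ : 0 < β) (hβr : 2 * β < r) (e : t) :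
    f '' shadowed f t ((1 - lam) * β) β e =
      ⋃ l ∈ {l : t | dist (f e) l ≤ (1 - lam) * β}, shadowed f t ((1 - lam) * β) β l := by
  have h0 := hf.lam_pos
  have h1 := hf.lam_lt_one
  ext y
  simp only [Set.mem_iUnion, Set.mem_ofPred_eq]
  constructor
  · rintro ⟨x, hx, rfl⟩
    obtain ⟨-, l, hl, hxl⟩ := mem_shadowed.mp hx
    exact ⟨l, hl, hxl⟩
  · rintro ⟨l, hl, hyl⟩
    obtain ⟨φ, hφ0, hφ1, hφ2⟩ := hf.exists_branch (f e) e rfl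
    have hyl' := (mem_shadowed.mp hyl).1
    have hd : dist y (f e) ≤ (2 - lam) * β := by
      have := dist_triangle_right y (f e) (l : K)
      linarith
    have hy : y ∈ Metric.ball (f e) r := Metric.mem_ball.mpr (by nlinarith)
    refine ⟨φ y, mem_shadowed.mpr ⟨?_, l, hl, by rwa [hφ1 y hy]⟩, hφ1 y hy⟩
    have h2 := hφ2 y hy (f e) (Metric.mem_ball_self hf.r_pos)
    rw [hφ0] at h2
    nlinarith [mul_le_mul_of_nonneg_left hd h0.le, mul_nonneg hβ.le (sq_nonneg (1 - lam))]

/-- Closed `γ`-balls around the net lie below their image under the operator, hence inside the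
shadowed sets, and they already cover. -/
theorem iUnion_shadowed {t : Set K} {α β γ : ℝ} (hγβ : γ ≤ β) (hγα : γ ≤ α / 2)
    (hnet : ∀ x : K, ∃ e : t, dist x e ≤ γ)
    (hfγ : ∀ x y, dist x y ≤ γ → dist (f x) (f y) ≤ α / 2) :
    ⋃ e, shadowed f t α β e = Set.univ := by
  have hle : (fun e : t => Metric.closedBall (e : K) γ) ≤
      shadowOperator f t α β fun e : t => Metric.closedBall (e : K) γ := by
    intro e x hx
    have hx' : dist x e ≤ γ := hx
    obtain ⟨l, hl⟩ := hnet (f x)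
    refine ⟨hx'.trans hγβ, l, ?_, hl⟩
    have h1 := hfγ _ _ hx'
    have h2 := dist_triangle_left (f e) (l : K) (f x)
    linarith
  refine Set.eq_univ_of_forall fun x => ?_
  obtain ⟨e, he⟩ := hnet x
  exact Set.mem_iUnion.mpr ⟨e, OrderHom.le_gfp _ hle e he⟩

theorem IsRuelleExpandingWith.exists_isMarkovCover [CompactSpace K]
    (hf : IsRuelleExpandingWith f r lam c) {δ : ℝ} (hδ : 0 < δ) :
    ∃ (k : ℕ) (R : Fin k → Set K), IsMarkovCover f R δ := by
  -- Shadowing is done at radius `β = η / 2`: the sets then have diameter at most `η`, and `2 * β <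
  -- r` holds.
  obtain ⟨η, hη0, hη⟩ := exists_between (lt_min hδ (lt_min hf.r_pos (div_pos hf.c_pos four_pos)))
  have hηδ : η < δ := hη.trans_le (min_le_left _ _)
  have hηr : η < r := hη.trans_le ((min_le_right _ _).trans (min_le_left _ _))
  have hηc : η < c / 4 := hη.trans_le ((min_le_right _ _).trans (min_le_right _ _))
  have hβ : 0 < η / 2 := half_pos hη0
  have hα : 0 < (1 - lam) * (η / 2) := mul_pos (sub_pos.mpr hf.lam_lt_one) hβ
  obtain ⟨γ₀, hγ₀, huc⟩ := Metric.uniformContinuous_iff.mp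
    (CompactSpace.uniformContinuous_of_continuous hf.continuous) _ (half_pos hα)
  obtain ⟨γ, hγ0, hγ⟩ := exists_between (lt_min hγ₀ (lt_min hβ (half_pos hα)))
  obtain ⟨t, -, ht, hcov⟩ := Metric.finite_approx_of_totallyBounded
    (isCompact_univ (X := K)).totallyBounded γ hγ0
  have := ht.to_subtype
  have hnet : ∀ x : K, ∃ e : t, dist x e ≤ γ := by
    intro x
    obtain ⟨e, he, hxe⟩ := Set.mem_iUnion₂.mp (hcov (Set.mem_univ x))
    exact ⟨⟨e, he⟩, (Metric.mem_ball.mp hxe).le⟩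
  refine exists_isMarkovCover_of_cover (P := shadowed f t ((1 - lam) * (η / 2)) (η / 2)) hf
    (fun e => isClosed_shadowed hf.continuous ht e)
    (iUnion_shadowed (γ := γ) ?_ ?_ hnet fun x y hxy => (huc ?_).le) (fun e x hx y hy => ?_) hη0 hηr
    (by linarith) (fun e => hf.image_shadowed hβ (by linarith) e) hηδ
  · exact (hγ.trans_le ((min_le_right _ _).trans (min_le_left _ _))).le
  · exact (hγ.trans_le ((min_le_right _ _).trans (min_le_right _ _))).le
  · exact hxy.trans_lt (hγ.trans_le (min_le_left _ _))
  · have h1 := (mem_shadowed.mp hx).1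
    have h2 := (mem_shadowed.mp hy).1
    linarith [dist_triangle_right x y (e : K)]

end Net

/-! ### The zeta function -/

theorem zetaSeries_eq_expLogSeries {K : Type*} (f : K → K) :
    zetaSeries f = expLogSeries fun n => (periodicCount f n : ℂ) :=
  rfl

/-- The index 0 is ignored, as it must be: the trace formula is available only for `n ≥ 1`. -/
theorem expLogSeries_congr {a b : ℕ → ℂ} (h : ∀ n, 1 ≤ n → a n = b n) :
    expLogSeries a = expLogSeries b := by
  have : logSeries a = logSeries b := by
    ext n
    simp only [logSeries, PowerSeries.coeff_mk]
    split_ifs with hn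
    · rfl
    · rw [h n (Nat.one_le_iff_ne_zero.mpr hn)]
  rw [expLogSeries, this, expLogSeries]

/-- The traces of the powers of the signed matrix of order `q`. -/
noncomputable def traceSequence {K : Type*} [MetricSpace K] (f : K → K) {k : ℕ}
    (R : Fin k → Set K) (q : ℕ) : ℕ → ℂ :=
  fun n => (signedMatrix f R q ^ n).trace

section Zeta

variable {K : Type*} [MetricSpace K] {f : K → K} {k : ℕ} {R : Fin k → Set K}

theorem expLogSeries_sum_trace (s : Finset ℕ) :
    expLogSeries (∑ q ∈ s, traceSequence f R q) *
      ((∏ q ∈ s, (1 - (Polynomial.X : ℂ[X]) • (signedMatrix f R q).map Polynomial.C).det : ℂ[X]) :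
        ℂ⟦X⟧) = 1 := by
  rw [expLogSeries_sum, ← Polynomial.coeToPowerSeries.ringHom_apply, map_prod,
    ← Finset.prod_mul_distrib]
  exact Finset.prod_eq_one fun q _ => expLogSeries_trace _

theorem coeff_zero_oddDet : (oddDet f R).coeff 0 = 1 := by
  rw [oddDet, Polynomial.coeff_zero_prod]
  exact Finset.prod_eq_one fun q _ => coeff_zero_det_one_sub_X_smul _

variable [CompactSpace K] {r lam c ε : ℝ}

/-- The periodic points are the signed difference of the traces of odd and even order. -/
theorem IsMarkovCover.periodicCount_add (h : IsMarkovCover f R (min ε (c / 2)))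
    (hf : IsRuelleExpandingWith f r lam c) (hε : IsExpansivityConstant f ε) {n : ℕ} (hn : 1 ≤ n) :
    ((fun n => (periodicCount f n : ℂ)) +
      ∑ q ∈ (Finset.Icc 1 k).filter (fun q => Even q), traceSequence f R q) n =
    (∑ q ∈ (Finset.Icc 1 k).filter (fun q => Odd q), traceSequence f R q) n := by
  rw [Pi.add_apply, Finset.sum_apply, Finset.sum_apply, h.periodicCount_eq hf hε hn,
    ← Finset.sum_filter_add_sum_filter_not _ (fun q => Even q)]
  simp only [Nat.not_even_iff_odd, traceSequence]
  have h1 : ∑ q ∈ (Finset.Icc 1 k).filter (fun q => Even q),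
      (-1) ^ (q + 1) * (signedMatrix f R q ^ n).trace =
      -∑ q ∈ (Finset.Icc 1 k).filter (fun q => Even q), (signedMatrix f R q ^ n).trace := by
    rw [← Finset.sum_neg_distrib]
    refine Finset.sum_congr rfl fun q hq => ?_
    rw [(Finset.mem_filter.mp hq).2.add_one.neg_one_pow, neg_one_mul]
  have h2 : ∑ q ∈ (Finset.Icc 1 k).filter (fun q => Odd q),
      (-1) ^ (q + 1) * (signedMatrix f R q ^ n).trace =
      ∑ q ∈ (Finset.Icc 1 k).filter (fun q => Odd q), (signedMatrix f R q ^ n).trace := by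
    refine Finset.sum_congr rfl fun q hq => ?_
    rw [(Finset.mem_filter.mp hq).2.add_one.neg_one_pow, one_mul]
  rw [h1, h2]
  ring

/-- Exponentiating the counting formula, zeta times the even exponential is the odd one, and these
exponentials invert `evenDet` and `oddDet`. -/
theorem IsMarkovCover.zetaSeries_mul_oddDet (h : IsMarkovCover f R (min ε (c / 2)))
    (hf : IsRuelleExpandingWith f r lam c) (hε : IsExpansivityConstant f ε) :
    zetaSeries f * (oddDet f R : ℂ⟦X⟧) = (evenDet f R : ℂ⟦X⟧) := by
  have h1 := expLogSeries_congr fun n hn => h.periodicCount_add hf hε hn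
  rw [expLogSeries_add, ← zetaSeries_eq_expLogSeries] at h1
  have h2 := expLogSeries_sum_trace (f := f) (R := R) ((Finset.Icc 1 k).filter fun q => Even q)
  have h3 := expLogSeries_sum_trace (f := f) (R := R) ((Finset.Icc 1 k).filter fun q => Odd q)
  change _ * (evenDet f R : ℂ⟦X⟧) = 1 at h2
  change _ * (oddDet f R : ℂ⟦X⟧) = 1 at h3
  rw [← h1] at h3
  linear_combination (evenDet f R : ℂ⟦X⟧) * h3 - zetaSeries f * (oddDet f R : ℂ⟦X⟧) * h2

theorem IsMarkovCover.exists_disc (h : IsMarkovCover f R (min ε (c / 2)))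
    (hf : IsRuelleExpandingWith f r lam c) (hε : IsExpansivityConstant f ε) :
    ∃ ρ : ℝ, 0 < ρ ∧ ∀ z : ℂ, ‖z‖ < ρ → (oddDet f R).eval z ≠ 0 ∧
      ∃ S : ℂ, HasSum (fun n : ℕ =>
          (periodicCount f (n + 1) : ℂ) / ((n + 1 : ℕ) : ℂ) * z ^ (n + 1)) S ∧
        Complex.exp S = (evenDet f R).eval z / (oddDet f R).eval z := by
  obtain ⟨ρ, hρ, hodd⟩ := exists_isLogOfInv_sum ((Finset.Icc 1 k).filter fun q => Odd q)
    (fun q => traceSequence f R q) _ fun q _ => exists_isLogOfInv_trace _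
  obtain ⟨σ, hσ, heven⟩ := exists_isLogOfInv_sum ((Finset.Icc 1 k).filter fun q => Even q)
    (fun q => traceSequence f R q) _ fun q _ => exists_isLogOfInv_trace _
  refine ⟨min ρ σ, lt_min hρ hσ, fun z hz => ?_⟩
  obtain ⟨h1, S, hS, hS'⟩ := hodd z (hz.trans_le (min_le_left _ _))
  obtain ⟨-, T, hT, hT'⟩ := heven z (hz.trans_le (min_le_right _ _))
  change (oddDet f R).eval z ≠ 0 at h1
  change _ * (oddDet f R).eval z = 1 at hS'
  change _ * (evenDet f R).eval z = 1 at hT'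
  refine ⟨h1, S - T, ?_, ?_⟩
  · have heq : ∀ n : ℕ, (periodicCount f (n + 1) : ℂ) / ((n + 1 : ℕ) : ℂ) * z ^ (n + 1) =
        (∑ q ∈ (Finset.Icc 1 k).filter (fun q => Odd q), traceSequence f R q) (n + 1) /
            ((n + 1 : ℕ) : ℂ) * z ^ (n + 1) -
          (∑ q ∈ (Finset.Icc 1 k).filter (fun q => Even q), traceSequence f R q) (n + 1) /
            ((n + 1 : ℕ) : ℂ) * z ^ (n + 1) := fun n => by
      rw [← h.periodicCount_add hf hε (Nat.le_add_left 1 n), Pi.add_apply]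
      ring
    simp_rw [heq]
    exact hS.sub hT
  · rw [Complex.exp_sub, div_eq_div_iff (Complex.exp_ne_zero T) h1, hS', mul_comm, hT']

end Zeta

end RuelleZeta

theorem theorem1 {K : Type*} [MetricSpace K] [CompactSpace K] (f : K → K) (r lam c : ℝ)
    (hf : RuelleZeta.IsRuelleExpandingWith f r lam c) :
    -- the zeta function is defined, and it is rational
    (∀ n : ℕ, 1 ≤ n → (Function.ptsOfPeriod f n).Finite) ∧
    RuelleZeta.IsRationalSeries (RuelleZeta.zetaSeries f) ∧
    -- expansivity constants and Markov covers of arbitrarily small diameter exist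
    (∃ ε : ℝ, RuelleZeta.IsExpansivityConstant f ε) ∧
    (∀ δ : ℝ, 0 < δ → ∃ (k : ℕ) (R : Fin k → Set K), RuelleZeta.IsMarkovCover f R δ) ∧
    -- every sufficiently fine Markov cover computes the zeta function
    (∀ ε : ℝ, RuelleZeta.IsExpansivityConstant f ε →
      ∀ (k : ℕ) (R : Fin k → Set K), RuelleZeta.IsMarkovCover f R (min ε (c / 2)) →
        -- as a formal power series
        ((RuelleZeta.oddDet f R).coeff 0 = 1 ∧
          RuelleZeta.zetaSeries f * (RuelleZeta.oddDet f R : PowerSeries ℂ) =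
            (RuelleZeta.evenDet f R : PowerSeries ℂ)) ∧
        -- and as a function on a disc around the origin
        ∃ ρ : ℝ, 0 < ρ ∧ ∀ z : ℂ, ‖z‖ < ρ →
          (RuelleZeta.oddDet f R).eval z ≠ 0 ∧
          ∃ S : ℂ, HasSum (fun n : ℕ =>
              (RuelleZeta.periodicCount f (n + 1) : ℂ) / ((n + 1 : ℕ) : ℂ) * z ^ (n + 1)) S ∧
            Complex.exp S = (RuelleZeta.evenDet f R).eval z / (RuelleZeta.oddDet f R).eval z) := by
  have hε := hf.isExpansivityConstant
  obtain ⟨k, R, hR⟩ := hf.exists_isMarkovCover (lt_min hε.1 (half_pos hf.c_pos))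
  refine ⟨fun n hn => hR.finite_ptsOfPeriod hε hn, ⟨RuelleZeta.evenDet f R, RuelleZeta.oddDet f R,
    fun h0 => ?_, ?_⟩, ⟨_, hε⟩, fun δ hδ => hf.exists_isMarkovCover hδ, fun ε' hε' k' R' hR' =>
    ⟨⟨RuelleZeta.coeff_zero_oddDet, hR'.zetaSeries_mul_oddDet hf hε'⟩, hR'.exists_disc hf hε'⟩⟩
  · have h1 := RuelleZeta.coeff_zero_oddDet (f := f) (R := R)
    rw [h0, Polynomial.coeff_zero] at h1
    exact zero_ne_one h1
  · rw [mul_comm]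
    exact hR.zetaSeries_mul_oddDet hf hε
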